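/- Let $n=3m$ be odd. Each of $n$ voters independently chooses one of the $3!$ strict rankings of the alternatives $a,b,c$ uniformly at random. For distinct alternatives $k,l$ let $x_i^{(kl)}=1$ if voter $i$ prefers $k$ to $l$ and $x_i^{(kl)}=-1$ otherwise, and let $\mathbf{x}^{(kl)}=(x_1^{(kl)},\dots,x_n^{(kl)})$. Let $f\colon\{-1,1\}^n\to\{-1,1\}$ be the majority of triplets, $$f(x_1,\dots,x_n)=\operatorname{sgn}\Big(\sum_{i=1}^m \operatorname{sgn}\big(x_{3i-2}+x_{3i-1}+x_{3i}\big)\Big),$$ and for $d>0$ let $\mathcal{E}_d$ be the event that $\big|\sum_{i=1}^n x_i^{(kl)}\big|\le d$ for every pair $k\neq l$ of alternatives. **Theorem.** There is an absolute constant $\alpha^*$ such that, with $d=\sqrt n/\log n$, $$\lim_{n\to\infty}\Pr\Big[f(\mathbf{x}^{(ab)})=f(\mathbf{x}^{(bc)})=f(\mathbf{x}^{(ca)})\ \Big|\ \mathcal{E}_d\Big]=\alpha^*,$$ where the limit is taken over the odd multiples $n$ of $3$. Moreover $\alpha^*\approx 23.2\%$, that is, $|\alpha^*-0.232|<0.0005$;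 in particular $\alpha^*\neq 1/4$. -/

import Mathlib

open Filter Topology MeasureTheory ProbabilityTheory

noncomputable section

namespace MajorityOfTriplets

/-- A strict ranking of the three alternatives `a = 0`, `b = 1`, `c = 2`: the permutation `σ`
puts alternative `k` in place `σ k`, place `0` being the best. There are `3! = 6` rankings. -/
abbrev Ranking : Type := Equiv.Perm (Fin 3)

instance : MeasurableSpace Ranking := ⊤

instance : DiscreteMeasurableSpace Ranking := ⟨fun _ => trivial⟩

/-- The law of the rankings of `n` voters who choose one of the `6` rankings independently and
uniformly at random (impartial culture). -/
def impartialCulture (n : ℕ) : Measure (Fin n → Ranking) :=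
  Measure.pi fun _ => uniformOn (Set.univ : Set Ranking)

instance : IsProbabilityMeasure (uniformOn (Set.univ : Set Ranking)) :=
  isProbabilityMeasure_uniformOn Set.finite_univ Set.univ_nonempty

instance (n : ℕ) : IsProbabilityMeasure (impartialCulture n) := by
  unfold impartialCulture
  infer_instance

/-- The vote of every voter in the pairwise election of `k` against `l`: `1` if the voter prefers
`k` to `l`, and `-1` otherwise. -/
def votes {n : ℕ} (r : Fin n → Ranking) (k l : Fin 3) : Fin n → ℤ :=
  fun i => if r i k < r i l then 1 else -1

/-- The event that the elections are `d`-close: for every two alternatives, the number of voters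
who prefer the first to the second and the number of voters who prefer the second to the first
differ by at most `d`. -/
def closeElections (n : ℕ) (d : ℝ) : Set (Fin n → Ranking) :=
  {r | ∀ k l : Fin 3, k ≠ l → |((∑ i, votes r k l i : ℤ) : ℝ)| ≤ d}

/-- The two-level majority: the sign of the sum of the signs of `x₁ + x₂ + x₃`, `x₄ + x₅ + x₆`, and
so on. For odd `m` and votes `1` and `-1` no sign is taken of `0`, so the value is `1` or `-1`. -/
def tripletMajority {m : ℕ} (x : Fin (3 * m) → ℤ) : ℤ :=
  Int.sign (∑ j : Fin m, Int.sign
    (x ⟨3 * j, by omega⟩ + x ⟨3 * j + 1, by omega⟩ + x ⟨3 * j + 2, by omega⟩))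

/-- The event of the Condorcet paradox when pairs of alternatives are compared by the two-level
majority: `f(x^(ab)) = f(x^(bc)) = f(x^(ca))`. -/
def condorcetParadox (m : ℕ) : Set (Fin (3 * m) → Ranking) :=
  {r | tripletMajority (votes r 0 1) = tripletMajority (votes r 1 2) ∧
    tripletMajority (votes r 1 2) = tripletMajority (votes r 2 0)}

/-- The closeness parameter `√n / log n`. -/
def closeness (n : ℕ) : ℝ := √(n : ℝ) / Real.log n

end MajorityOfTriplets

end

noncomputable section

namespace MajorityOfTriplets

section ConditionalCLT

variable {Ω ι : Type*} [Fintype Ω] [Fintype ι]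

/-- The second-order expansion of the exponential on the imaginary axis, at scale `1 / √m`. -/
lemma tendsto_natCast_mul_cexp_sub (a : ℝ) :
    Tendsto (fun m : ℕ => (m : ℂ) *
      (Complex.exp (Complex.I * ((√(m : ℝ))⁻¹ * a : ℝ)) - 1 - Complex.I * ((√(m : ℝ))⁻¹ * a : ℝ)))
      atTop (𝓝 (-(a : ℂ) ^ 2 / 2)) := by
  have hs : Tendsto (fun m : ℕ => (√(m : ℝ))⁻¹) atTop (𝓝 0) :=
    tendsto_inv_atTop_zero.comp (Real.tendsto_sqrt_atTop.comp tendsto_natCast_atTop_atTop)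
  have hx : Tendsto (fun m : ℕ => Complex.I * ((√(m : ℝ))⁻¹ * a : ℝ)) atTop (𝓝 0) := by
    have h : Continuous fun s : ℝ => Complex.I * ((s * a : ℝ) : ℂ) := by fun_prop
    have h2 := (h.tendsto 0).comp hs
    rw [show Complex.I * ((0 * a : ℝ) : ℂ) = 0 by simp] at h2
    exact h2
  obtain ⟨C, hC⟩ := ((Complex.exp_sub_sum_range_isBigO_pow 3).comp_tendsto hx).bound
  rw [← tendsto_sub_nhds_zero_iff]
  refine squeeze_zero_norm' (a := fun m : ℕ => (√(m : ℝ))⁻¹ * (C * |a| ^ 3)) ?_ ?_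
  · filter_upwards [hC, eventually_gt_atTop 0] with m hm hm0
    have hm1 : (0 : ℝ) < m := by exact_mod_cast hm0
    have hsq : (√(m : ℝ)) ^ 2 = m := Real.sq_sqrt hm1.le
    have hsp : 0 < √(m : ℝ) := Real.sqrt_pos.2 hm1
    have hsc : ((√(m : ℝ) : ℝ) : ℂ) ^ 2 = m := by exact_mod_cast hsq
    have hsn : ((√(m : ℝ) : ℝ) : ℂ) ≠ 0 := by exact_mod_cast hsp.ne'
    have key : (m : ℂ) * (Complex.exp (Complex.I * ((√(m : ℝ))⁻¹ * a : ℝ)) - 1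
        - Complex.I * ((√(m : ℝ))⁻¹ * a : ℝ)) - -(a : ℂ) ^ 2 / 2
        = m * (Complex.exp (Complex.I * ((√(m : ℝ))⁻¹ * a : ℝ)) - ∑ i ∈ Finset.range 3,
          (Complex.I * ((√(m : ℝ))⁻¹ * a : ℝ)) ^ i / (i.factorial : ℂ)) := by
      simp only [Finset.sum_range_succ, Finset.sum_range_zero, Nat.factorial, mul_pow, Complex.I_sq]
      push_cast
      rw [← hsc]
      field_simp
      ring
    rw [key, norm_mul, Complex.norm_natCast]
    simp only [Function.comp_apply, norm_pow, norm_mul, Complex.norm_I, Complex.norm_real,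
      Real.norm_eq_abs, one_mul, abs_inv, abs_of_pos hsp] at hm
    calc (m : ℝ) * _ ≤ m * (C * ((√(m : ℝ))⁻¹ * |a|) ^ 3) := by gcongr
      _ = _ := by
        have h3 : (m : ℝ) * (√(m : ℝ))⁻¹ ^ 3 = (√(m : ℝ))⁻¹ := by
          nth_rewrite 1 [← hsq]; field_simp
        linear_combination (C * |a| ^ 3) * h3
  · simpa using hs.mul_const (C * |a| ^ 3)

/-- The central limit theorem for the characteristic function of a centered uniform average. -/
lemma tendsto_average_cexp_pow [Nonempty Ω] (Z : Ω → ℝ) (h0 : ∑ ω, Z ω = 0) :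
    Tendsto (fun m : ℕ => ((Fintype.card Ω : ℂ)⁻¹ *
      ∑ ω, Complex.exp (Complex.I * ((√(m : ℝ))⁻¹ * Z ω : ℝ))) ^ m) atTop
      (𝓝 (Real.exp (-((Fintype.card Ω : ℝ)⁻¹ * ∑ ω, Z ω ^ 2) / 2) : ℝ)) := by
  have hc : (Fintype.card Ω : ℂ) ≠ 0 := by exact_mod_cast Fintype.card_ne_zero
  have h : ∀ m : ℕ, (Fintype.card Ω : ℂ)⁻¹ *
      ∑ ω, Complex.exp (Complex.I * ((√(m : ℝ))⁻¹ * Z ω : ℝ)) = 1 + (Fintype.card Ω : ℂ)⁻¹ *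
      ∑ ω, (Complex.exp (Complex.I * ((√(m : ℝ))⁻¹ * Z ω : ℝ)) - 1
        - Complex.I * ((√(m : ℝ))⁻¹ * Z ω : ℝ)) := by
    intro m
    have h1 : ∑ ω, Complex.I * (((√(m : ℝ))⁻¹ * Z ω : ℝ) : ℂ) = 0 := by
      rw [← Finset.mul_sum, ← Complex.ofReal_sum, ← Finset.mul_sum, h0]; simp
    rw [Finset.sum_sub_distrib, Finset.sum_sub_distrib, h1]
    simp only [Finset.sum_const, Finset.card_univ, nsmul_eq_mul, mul_one, sub_zero]
    field_simp
    ring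
  simp_rw [h]
  rw [Complex.ofReal_exp]
  refine Complex.tendsto_one_add_pow_exp_of_tendsto ?_
  have := (tendsto_finsetSum Finset.univ fun ω _ => tendsto_natCast_mul_cexp_sub (Z ω)).const_mul
    (Fintype.card Ω : ℂ)⁻¹
  refine (this.congr fun m => ?_).trans_eq ?_
  · rw [← Finset.mul_sum]; ring
  · congr 1
    push_cast
    rw [← Finset.sum_div, Finset.sum_neg_distrib]
    ring

/-- The odd integers of absolute value at most `d`. -/
def oddWindow (d : ℝ) : Finset ℤ := (Finset.Icc (-⌊d⌋) ⌊d⌋).filter Odd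

lemma mem_oddWindow {d : ℝ} {t : ℤ} : t ∈ oddWindow d ↔ |(t : ℝ)| ≤ d ∧ Odd t := by
  rw [oddWindow, Finset.mem_filter, Finset.mem_Icc, ← abs_le, Int.le_floor, Int.cast_abs]

/-- The sum of the characters `u ↦ e^{-iut}` over the odd integers `t` with `|t| ≤ d`. -/
def windowKernel (d u : ℝ) : ℂ := ∑ t ∈ oddWindow d, Complex.exp (-(Complex.I * (u * t : ℝ)))

@[fun_prop]
lemma continuous_windowKernel (d : ℝ) : Continuous (windowKernel d) := by
  unfold windowKernel
  fun_prop

lemma integral_cexp_even (j : ℤ) :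
    ∫ u in (-(Real.pi / 2))..(Real.pi / 2), Complex.exp (Complex.I * (u * (2 * j : ℤ) : ℝ))
      = if j = 0 then (Real.pi : ℂ) else 0 := by
  split_ifs with hj
  · subst hj
    simp only [mul_zero, Int.cast_zero, Complex.ofReal_zero, Complex.exp_zero,
      intervalIntegral.integral_const, Complex.real_smul, mul_one]
    push_cast; ring
  · have hc : (Complex.I * (2 * j)) ≠ 0 := by simp [hj]
    have := integral_exp_mul_complex (a := -(Real.pi / 2)) (b := Real.pi / 2) hc
    have e : ∀ u : ℝ, Complex.exp (Complex.I * (u * (2 * j : ℤ) : ℝ))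
        = Complex.exp (Complex.I * (2 * j) * u) := by
      intro u; congr 1; push_cast; ring
    simp_rw [e]
    rw [this, div_eq_zero_iff]
    left
    rw [sub_eq_zero, Complex.exp_eq_exp_iff_exists_int]
    exact ⟨j, by push_cast; ring⟩

/-- Fourier inversion for the indicator function of a window of odd integers. -/
lemma integral_cexp_mul_windowKernel (d : ℝ) {a : ℤ} (ha : Odd a) :
    ∫ u in (-(Real.pi / 2))..(Real.pi / 2),
      windowKernel d u * Complex.exp (Complex.I * (u * a : ℝ))
      = if |(a : ℝ)| ≤ d then (Real.pi : ℂ) else 0 := by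
  have e : ∀ u : ℝ, windowKernel d u * Complex.exp (Complex.I * (u * a : ℝ))
      = ∑ t ∈ oddWindow d, Complex.exp (Complex.I * (u * (a - t : ℤ) : ℝ)) := by
    intro u
    rw [windowKernel, Finset.sum_mul]
    refine Finset.sum_congr rfl fun t _ => ?_
    rw [← Complex.exp_add]; congr 1; push_cast; ring
  simp_rw [e]
  rw [intervalIntegral.integral_finsetSum fun t _ => Continuous.intervalIntegrable (by fun_prop) _ _]
  have h2 : ∀ t ∈ oddWindow d, ∫ u in (-(Real.pi / 2))..(Real.pi / 2),
      Complex.exp (Complex.I * (u * (a - t : ℤ) : ℝ)) = if a = t then (Real.pi : ℂ) else 0 := by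
    intro t ht
    obtain ⟨j, hj⟩ := (ha.sub_odd (mem_oddWindow.1 ht).2).two_dvd
    rw [hj, integral_cexp_even]
    refine if_congr ?_ rfl rfl
    omega
  rw [Finset.sum_congr rfl h2, Finset.sum_ite_eq]
  exact if_congr (by simp [mem_oddWindow, ha]) rfl rfl

/-- The characteristic function of the uniform law of `(T, Y)` at `(u, 1)`. -/
def phaseAverage (T : Ω → ι → ℤ) (Y : Ω → ℝ) (u : ι → ℝ) : ℂ :=
  (Fintype.card Ω : ℂ)⁻¹ * ∑ ω, Complex.exp (Complex.I * (∑ k, u k * T ω k + Y ω : ℝ))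

@[fun_prop]
lemma continuous_phaseAverage (T : Ω → ι → ℤ) (Y : Ω → ℝ) : Continuous (phaseAverage T Y) := by
  unfold phaseAverage
  fun_prop

lemma norm_phaseAverage_le_one [Nonempty Ω] (T : Ω → ι → ℤ) (Y : Ω → ℝ) (u : ι → ℝ) :
    ‖phaseAverage T Y u‖ ≤ 1 := by
  have hc : (0 : ℝ) < Fintype.card Ω := by exact_mod_cast Fintype.card_pos
  rw [phaseAverage, norm_mul, norm_inv, Complex.norm_natCast, inv_mul_le_iff₀ hc, mul_one]
  refine (norm_sum_le _ _).trans_eq ?_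
  simp_rw [Complex.norm_exp_I_mul_ofReal]
  simp

/-- The window kernel on the cell `(-π/2, π/2]`, extended by zero. -/
def cellKernel (d : ℝ) : ℝ → ℂ := (Set.Ioc (-(Real.pi / 2)) (Real.pi / 2)).indicator (windowKernel d)

lemma measurable_cellKernel (d : ℝ) : Measurable (cellKernel d) :=
  (continuous_windowKernel d).measurable.indicator measurableSet_Ioc

lemma integrable_cellKernel_mul (d : ℝ) {g : ℝ → ℂ} (hg : Continuous g) :
    Integrable fun u => cellKernel d u * g u := by
  have : (fun u => cellKernel d u * g u)
      = (Set.Ioc (-(Real.pi / 2)) (Real.pi / 2)).indicator fun u => windowKernel d u * g u := by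
    ext u; simp only [cellKernel, Set.indicator]; split_ifs <;> simp
  rw [this, integrable_indicator_iff measurableSet_Ioc]
  exact (Continuous.integrableOn_Icc (by fun_prop)).mono_set Set.Ioc_subset_Icc_self

lemma integral_cellKernel_mul_cexp (d : ℝ) {a : ℤ} (ha : Odd a) :
    ∫ u, cellKernel d u * Complex.exp (Complex.I * (u * a : ℝ))
      = if |(a : ℝ)| ≤ d then (Real.pi : ℂ) else 0 := by
  rw [← integral_cexp_mul_windowKernel d ha, intervalIntegral.integral_of_le
    (by linarith [Real.pi_pos]), ← integral_indicator measurableSet_Ioc]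
  congr 1
  ext u; simp only [cellKernel, Set.indicator]; split_ifs <;> simp

/-- Fourier inversion for the sum of the phases `e^{i ∑ Y}` over the outcomes for which all the
coordinates of `∑ T` lie in the window. -/
theorem sum_window_cexp_eq_integral [Nonempty Ω] (T : Ω → ι → ℤ) (Y : Ω → ℝ) (d : ℝ) {m : ℕ}
    (hodd : ∀ (ω : Fin m → Ω) (k : ι), Odd (∑ j, T (ω j) k)) :
    ∑ ω : Fin m → Ω, (if ∀ k, |((∑ j, T (ω j) k : ℤ) : ℝ)| ≤ d then
        Complex.exp (Complex.I * (∑ j, Y (ω j) : ℝ)) else 0)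
      = ((Real.pi : ℂ) ^ Fintype.card ι)⁻¹ * (Fintype.card Ω : ℂ) ^ m *
        ∫ u : ι → ℝ, (∏ k, cellKernel d (u k)) * phaseAverage T Y u ^ m := by
  have hc : (Fintype.card Ω : ℂ) ≠ 0 := by exact_mod_cast Fintype.card_ne_zero
  have hp : (Real.pi : ℂ) ≠ 0 := by exact_mod_cast Real.pi_ne_zero
  have e : ∀ u : ι → ℝ, (Fintype.card Ω : ℂ) ^ m * ((∏ k, cellKernel d (u k)) *
      phaseAverage T Y u ^ m) = ∑ ω : Fin m → Ω, Complex.exp (Complex.I * (∑ j, Y (ω j) : ℝ)) *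
        ∏ k, (cellKernel d (u k) *
          Complex.exp (Complex.I * (u k * (∑ j, T (ω j) k : ℤ) : ℝ))) := by
    intro u
    rw [phaseAverage, mul_pow, inv_pow, Fintype.sum_pow]
    field_simp
    rw [Finset.mul_sum]
    refine Finset.sum_congr rfl fun ω _ => ?_
    have hE : ∑ j, Complex.I * ((∑ k, u k * T (ω j) k + Y (ω j) : ℝ) : ℂ)
        = Complex.I * ((∑ j, Y (ω j) : ℝ) : ℂ)
          + ∑ k, Complex.I * ((u k * (∑ j, T (ω j) k : ℤ) : ℝ) : ℂ) := by
      push_cast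
      simp_rw [mul_add, Finset.sum_add_distrib, Finset.mul_sum]
      rw [add_comm, Finset.sum_comm]
    rw [Finset.prod_mul_distrib, ← Complex.exp_sum, ← Complex.exp_sum, hE, Complex.exp_add]
    ring
  rw [mul_assoc, ← integral_const_mul]
  simp_rw [e]
  rw [integral_finsetSum]
  · rw [Finset.mul_sum]
    refine Finset.sum_congr rfl fun ω _ => ?_
    rw [integral_const_mul, integral_fintype_prod_volume_eq_prod
      fun k (x : ℝ) => cellKernel d x * Complex.exp (Complex.I * (x * (∑ j, T (ω j) k : ℤ) : ℝ))]
    simp_rw [integral_cellKernel_mul_cexp d (hodd ω _)]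
    split_ifs with h
    · rw [Finset.prod_congr rfl fun k _ => if_pos (h k)]
      rw [Finset.prod_const, Finset.card_univ]
      field_simp
    · push Not at h
      obtain ⟨k, hk⟩ := h
      rw [Finset.prod_eq_zero (Finset.mem_univ k) (if_neg hk.not_ge)]
      simp
  · intro ω _
    refine Integrable.const_mul ?_ _
    exact Integrable.fintype_prod (f := fun k (x : ℝ) => cellKernel d x *
      Complex.exp (Complex.I * (x * (∑ j, T (ω j) k : ℤ) : ℝ)))
      fun k => integrable_cellKernel_mul d (by fun_prop)

lemma norm_windowKernel_le (d u : ℝ) : ‖windowKernel d u‖ ≤ (oddWindow d).card := by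
  refine (norm_sum_le _ _).trans_eq ?_
  have : ∀ t : ℤ, ‖Complex.exp (-(Complex.I * (u * t : ℝ)))‖ = 1 := by
    intro t
    rw [show -(Complex.I * ((u * t : ℝ) : ℂ)) = Complex.I * ((-(u * t) : ℝ) : ℂ) by push_cast; ring,
      Complex.norm_exp_I_mul_ofReal]
  simp_rw [this]
  simp

lemma norm_cellKernel_div_le_one (d u : ℝ) : ‖cellKernel d u / (oddWindow d).card‖ ≤ 1 := by
  rw [norm_div, Complex.norm_natCast]
  refine div_le_one_of_le₀ ?_ (by positivity)
  unfold cellKernel Set.indicator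
  split_ifs
  · exact norm_windowKernel_le d u
  · simp

lemma norm_cexp_I_mul_sub_le (a b : ℝ) :
    ‖Complex.exp (Complex.I * a) - Complex.exp (Complex.I * b)‖ ≤ |a - b| := by
  have : Complex.exp (Complex.I * a) - Complex.exp (Complex.I * b)
      = Complex.exp (Complex.I * b) * (Complex.exp (Complex.I * (a - b : ℝ)) - 1) := by
    rw [mul_sub, ← Complex.exp_add, mul_one]; congr 2; push_cast; ring
  rw [this, norm_mul, Complex.norm_exp_I_mul_ofReal, one_mul, mul_comm]
  simpa [mul_comm] using Real.norm_exp_I_mul_ofReal_sub_one_le (x := a - b)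

lemma norm_windowKernel_div_sub_one_le {d : ℝ} (hd : (oddWindow d).Nonempty) (u : ℝ) :
    ‖windowKernel d u / (oddWindow d).card - 1‖ ≤ |u| * d := by
  have hN : (0 : ℝ) < (oddWindow d).card := by exact_mod_cast hd.card_pos
  have hN' : ((oddWindow d).card : ℂ) ≠ 0 := by exact_mod_cast hd.card_pos.ne'
  have : windowKernel d u / (oddWindow d).card - 1
      = (∑ t ∈ oddWindow d, (Complex.exp (Complex.I * (-(u * t) : ℝ))
        - Complex.exp (Complex.I * (0 : ℝ)))) / (oddWindow d).card := by
    rw [Finset.sum_sub_distrib, windowKernel]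
    simp only [Complex.ofReal_zero, mul_zero, Complex.exp_zero, Finset.sum_const, nsmul_eq_mul,
      mul_one, sub_div, div_self hN']
    simp
  rw [this, norm_div, Complex.norm_natCast, div_le_iff₀ hN]
  refine (norm_sum_le _ _).trans ((Finset.sum_le_card_nsmul _ _ (|u| * d) fun t ht => ?_).trans_eq ?_)
  · refine (norm_cexp_I_mul_sub_le _ _).trans ?_
    rw [sub_zero, abs_neg, abs_mul]
    exact mul_le_mul_of_nonneg_left (mem_oddWindow.1 ht).1 (abs_nonneg u)
  · rw [nsmul_eq_mul]; ring

/-- Gaussian decay of the characteristic function of `(T, s Y)` on the cell, for small `s`. -/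
def PhaseDecay (T : Ω → ι → ℤ) (Y : Ω → ℝ) : Prop :=
  ∃ c > 0, ∀ᶠ s in 𝓝 (0 : ℝ), ∀ u : ι → ℝ, (∀ k, |u k| ≤ Real.pi / 2) →
    ‖phaseAverage T (s • Y) u‖ ≤ Real.exp (-c * ∑ k, u k ^ 2)

lemma PhaseDecay.zero {T : Ω → ι → ℤ} {Y : Ω → ℝ} (h : PhaseDecay T Y) :
    PhaseDecay T (0 : Ω → ℝ) := by
  obtain ⟨c, hc, h⟩ := h
  refine ⟨c, hc, Eventually.of_forall fun s u hu => ?_⟩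
  simpa using h.self_of_nhds u hu

/-- The second moment of `v · T + Y` under the uniform law. -/
def phaseVariance (T : Ω → ι → ℤ) (Y : Ω → ℝ) (v : ι → ℝ) : ℝ :=
  (Fintype.card Ω : ℝ)⁻¹ * ∑ ω, (∑ k, v k * T ω k + Y ω) ^ 2

lemma phaseVariance_eq_add {T : Ω → ι → ℤ} {Y : Ω → ℝ} (hTY : ∀ k, ∑ ω, (T ω k : ℝ) * Y ω = 0)
    (v : ι → ℝ) : phaseVariance T Y v
      = phaseVariance T 0 v + (Fintype.card Ω : ℝ)⁻¹ * ∑ ω, Y ω ^ 2 := by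
  have h : ∑ ω, (∑ k, v k * T ω k) * Y ω = 0 := by
    simp_rw [Finset.sum_mul, mul_assoc]
    rw [Finset.sum_comm]
    simp_rw [← Finset.mul_sum, hTY]
    simp
  rw [phaseVariance, phaseVariance, ← mul_add, ← Finset.sum_add_distrib]
  congr 1
  have : ∀ ω, (∑ k, v k * (T ω k : ℝ) + Y ω) ^ 2
      = ((∑ k, v k * (T ω k : ℝ) + (0 : Ω → ℝ) ω) ^ 2 + Y ω ^ 2)
        + 2 * ((∑ k, v k * (T ω k : ℝ)) * Y ω) := by
    intro ω; simp; ring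
  simp_rw [this]
  rw [Finset.sum_add_distrib, ← Finset.mul_sum, h]; simp

lemma tendsto_inv_sqrt_natCast : Tendsto (fun m : ℕ => (√(m : ℝ))⁻¹) atTop (𝓝 0) :=
  tendsto_inv_atTop_zero.comp (Real.tendsto_sqrt_atTop.comp tendsto_natCast_atTop_atTop)

lemma tendsto_phaseAverage_pow [Nonempty Ω] {T : Ω → ι → ℤ} {Y : Ω → ℝ}
    (hT : ∀ k, ∑ ω, T ω k = 0) (hY : ∑ ω, Y ω = 0) (v : ι → ℝ) :
    Tendsto (fun m : ℕ => phaseAverage T ((√(m : ℝ))⁻¹ • Y) ((√(m : ℝ))⁻¹ • v) ^ m) atTop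
      (𝓝 (Real.exp (-phaseVariance T Y v / 2) : ℝ)) := by
  have h0 : ∑ ω, (∑ k, v k * T ω k + Y ω) = 0 := by
    rw [Finset.sum_add_distrib, hY, Finset.sum_comm]
    simp_rw [← Finset.mul_sum]
    have : ∀ k, ∑ ω, (T ω k : ℝ) = 0 := fun k => by exact_mod_cast hT k
    simp [this]
  refine (tendsto_average_cexp_pow _ h0).congr fun m => ?_
  rw [phaseAverage]
  congr 2
  refine Finset.sum_congr rfl fun ω _ => ?_
  congr 3
  simp only [Pi.smul_apply, smul_eq_mul, mul_add, Finset.mul_sum, mul_assoc]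

lemma integrable_exp_neg_mul_sum_sq {c : ℝ} (hc : 0 < c) :
    Integrable fun v : ι → ℝ => Real.exp (-c * ∑ k, v k ^ 2) := by
  simp_rw [Finset.mul_sum, Real.exp_sum]
  exact Integrable.fintype_prod (f := fun _ x => Real.exp (-c * x ^ 2))
    fun _ => integrable_exp_neg_mul_sq hc

lemma PhaseDecay.norm_pow_le {T : Ω → ι → ℤ} {Y : Ω → ℝ} (h : PhaseDecay T Y) :
    ∃ c > 0, ∀ᶠ m : ℕ in atTop, ∀ v : ι → ℝ, (∀ k, |(√(m : ℝ))⁻¹ * v k| ≤ Real.pi / 2) →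
      ‖phaseAverage T ((√(m : ℝ))⁻¹ • Y) ((√(m : ℝ))⁻¹ • v) ^ m‖ ≤
        Real.exp (-c * ∑ k, v k ^ 2) := by
  obtain ⟨c, hc, h⟩ := h
  refine ⟨c, hc, ?_⟩
  filter_upwards [tendsto_inv_sqrt_natCast.eventually h, eventually_gt_atTop 0] with m hm hm0 v hv
  have hm1 : (0 : ℝ) < m := by exact_mod_cast hm0
  rw [norm_pow]
  refine (pow_le_pow_left₀ (norm_nonneg _) (hm _ fun k => ?_) m).trans_eq ?_
  · simpa using hv k
  · rw [← Real.exp_nat_mul]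
    congr 1
    simp only [Pi.smul_apply, smul_eq_mul, mul_pow, inv_pow, Real.sq_sqrt hm1.le]
    rw [← Finset.mul_sum]
    field_simp

lemma integrable_exp_neg_phaseVariance [Nonempty Ω] {T : Ω → ι → ℤ} {Y : Ω → ℝ}
    (hT : ∀ k, ∑ ω, T ω k = 0) (hY : ∑ ω, Y ω = 0) (h : PhaseDecay T Y) :
    Integrable fun v : ι → ℝ => Real.exp (-phaseVariance T Y v / 2) := by
  obtain ⟨c, hc, h⟩ := h.norm_pow_le
  refine (integrable_exp_neg_mul_sum_sq hc).mono' ?_ (ae_of_all _ fun v => ?_)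
  · unfold phaseVariance
    exact Continuous.aestronglyMeasurable (by fun_prop)
  · have h1 := (tendsto_phaseAverage_pow hT hY v).norm
    rw [Complex.norm_real] at h1
    refine le_of_tendsto h1 ?_
    have h2 : ∀ᶠ m : ℕ in atTop, ∀ k, |(√(m : ℝ))⁻¹ * v k| ≤ Real.pi / 2 := by
      refine eventually_all.2 fun k => ?_
      have h3 := (tendsto_inv_sqrt_natCast.mul_const (v k)).abs
      rw [zero_mul, abs_zero] at h3
      exact h3.eventually_le_const (by positivity)
    filter_upwards [h, h2] with m hm hm2 using hm v hm2

/-- The rescaled Fourier integrals converge to a Gaussian integral. -/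
theorem tendsto_integral_cellKernel [Nonempty Ω] {T : Ω → ι → ℤ} {Y : Ω → ℝ} {d : ℕ → ℝ}
    (hT : ∀ k, ∑ ω, T ω k = 0) (hY : ∑ ω, Y ω = 0) (h : PhaseDecay T Y)
    (hd : ∀ᶠ m in atTop, (oddWindow (d m)).Nonempty)
    (hd0 : Tendsto (fun m : ℕ => (√(m : ℝ))⁻¹ * d m) atTop (𝓝 0)) :
    Tendsto (fun m : ℕ => ∫ v : ι → ℝ,
      (∏ k, cellKernel (d m) ((√(m : ℝ))⁻¹ * v k) / (oddWindow (d m)).card) *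
        phaseAverage T ((√(m : ℝ))⁻¹ • Y) ((√(m : ℝ))⁻¹ • v) ^ m) atTop
      (𝓝 (∫ v : ι → ℝ, (Real.exp (-phaseVariance T Y v / 2) : ℂ))) := by
  obtain ⟨c, hc, hb⟩ := h.norm_pow_le
  refine tendsto_integral_filter_of_dominated_convergence
    (fun v => Real.exp (-c * ∑ k, v k ^ 2)) ?_ ?_ (integrable_exp_neg_mul_sum_sq hc) ?_
  · refine Eventually.of_forall fun m => Measurable.aestronglyMeasurable ?_
    refine Measurable.mul ?_ (Continuous.measurable (by fun_prop))
    exact Finset.measurable_prod _ fun k _ =>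
      ((measurable_cellKernel _).comp (by fun_prop)).div_const _
  · filter_upwards [hb] with m hm
    refine ae_of_all _ fun v => ?_
    by_cases hv : ∀ k, |(√(m : ℝ))⁻¹ * v k| ≤ Real.pi / 2
    · rw [norm_mul]
      refine (mul_le_of_le_one_left (norm_nonneg _) ?_).trans (hm v hv)
      rw [norm_prod]
      exact Finset.prod_le_one (fun _ _ => norm_nonneg _) fun k _ => norm_cellKernel_div_le_one _ _
    · push Not at hv
      obtain ⟨k, hk⟩ := hv
      rw [Finset.prod_eq_zero (Finset.mem_univ k)]
      · simp only [zero_mul, norm_zero]; positivity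
      · rw [cellKernel, Set.indicator_of_notMem, zero_div]
        rintro ⟨h1, h2⟩
        exact hk.not_ge (abs_le.2 ⟨h1.le, h2⟩)
  · refine ae_of_all _ fun v => ?_
    rw [← one_mul (Complex.ofReal _)]
    refine Tendsto.mul ?_ (tendsto_phaseAverage_pow hT hY v)
    rw [← Finset.prod_const_one (s := (Finset.univ : Finset ι))]
    refine tendsto_finsetProd _ fun k _ => ?_
    have h3 := tendsto_inv_sqrt_natCast.mul_const (v k)
    rw [zero_mul] at h3
    have h4 : ∀ᶠ m : ℕ in atTop, (√(m : ℝ))⁻¹ * v k ∈ Set.Ioc (-(Real.pi / 2)) (Real.pi / 2) :=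
      h3.eventually (Ioc_mem_nhds (by linarith [Real.pi_pos]) (by positivity))
    rw [← tendsto_sub_nhds_zero_iff]
    refine squeeze_zero_norm' (a := fun m : ℕ => |v k| * ((√(m : ℝ))⁻¹ * d m)) ?_ ?_
    · filter_upwards [h4, hd] with m hm hdm
      rw [cellKernel, Set.indicator_of_mem hm]
      refine (norm_windowKernel_div_sub_one_le hdm _).trans_eq ?_
      rw [abs_mul, abs_of_nonneg (by positivity : 0 ≤ (√(m : ℝ))⁻¹)]
      ring
    · simpa using hd0.const_mul |v k|

lemma integral_cellKernel_rescale (T : Ω → ι → ℤ) (Y : Ω → ℝ) {d : ℝ} {m : ℕ} (hm : 0 < m)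
    (hd : (oddWindow d).Nonempty) :
    ∫ u : ι → ℝ, (∏ k, cellKernel d (u k)) * phaseAverage T Y u ^ m
      = (((oddWindow d).card : ℂ) ^ Fintype.card ι / (√(m : ℝ) : ℂ) ^ Fintype.card ι) *
        ∫ v : ι → ℝ, (∏ k, cellKernel d ((√(m : ℝ))⁻¹ * v k) / (oddWindow d).card) *
          phaseAverage T Y ((√(m : ℝ))⁻¹ • v) ^ m := by
  have hN : ((oddWindow d).card : ℂ) ≠ 0 := by exact_mod_cast hd.card_pos.ne'
  have hs : 0 < √(m : ℝ) := Real.sqrt_pos.2 (by exact_mod_cast hm)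
  have hs' : (√(m : ℝ) : ℂ) ≠ 0 := by exact_mod_cast hs.ne'
  have h1 := Measure.integral_comp_smul (volume : Measure (ι → ℝ))
    (fun u : ι → ℝ => (∏ k, cellKernel d (u k)) * phaseAverage T Y u ^ m) (√(m : ℝ))⁻¹
  rw [Module.finrank_fintype_fun_eq_card, abs_of_pos (by positivity)] at h1
  simp only [Pi.smul_apply, smul_eq_mul, Complex.real_smul, inv_pow, inv_inv] at h1
  simp_rw [Finset.prod_div_distrib, Finset.prod_const, Finset.card_univ, div_mul_eq_mul_div]
  rw [integral_div, h1]
  push_cast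
  field_simp

/-- A conditional central limit theorem: if `T` and `Y` are centered and uncorrelated, then the
characteristic functions of `m^{-1/2} ∑ Y` given that the coordinates of `∑ T` lie in a window of
size `o(√m)` converge to that of a centered normal law. -/
theorem tendsto_conditional_cexp [Nonempty Ω] {T : Ω → ι → ℤ} {Y : Ω → ℝ} {d : ℕ → ℝ}
    (hodd : ∀ ω k, Odd (T ω k))
    (hT : ∀ k, ∑ ω, T ω k = 0) (hY : ∑ ω, Y ω = 0) (hTY : ∀ k, ∑ ω, (T ω k : ℝ) * Y ω = 0)
    (h : PhaseDecay T Y) (hd : ∀ᶠ m in atTop, (oddWindow (d m)).Nonempty)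
    (hd0 : Tendsto (fun m : ℕ => (√(m : ℝ))⁻¹ * d m) atTop (𝓝 0)) :
    Tendsto (fun m : ℕ =>
      (∑ ω : Fin m → Ω, if ∀ k, |((∑ j, T (ω j) k : ℤ) : ℝ)| ≤ d m then
        Complex.exp (Complex.I * (∑ j, (√(m : ℝ))⁻¹ * Y (ω j) : ℝ)) else 0) /
      (∑ ω : Fin m → Ω, if ∀ k, |((∑ j, T (ω j) k : ℤ) : ℝ)| ≤ d m then (1 : ℂ) else 0))
      (atTop ⊓ 𝓟 {m | Odd m})
      (𝓝 (Real.exp (-((Fintype.card Ω : ℝ)⁻¹ * ∑ ω, Y ω ^ 2) / 2) : ℝ)) := by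
  set G : ℂ := ∫ v : ι → ℝ, (Real.exp (-phaseVariance T 0 v / 2) : ℂ) with hG
  have hGne : G ≠ 0 := by
    rw [hG, integral_complex_ofReal]
    have := integrable_exp_neg_phaseVariance hT (by simp) h.zero
    exact_mod_cast (integral_exp_pos this).ne'
  have hlim : (∫ v : ι → ℝ, (Real.exp (-phaseVariance T Y v / 2) : ℂ)) / G
      = (Real.exp (-((Fintype.card Ω : ℝ)⁻¹ * ∑ ω, Y ω ^ 2) / 2) : ℝ) := by
    rw [div_eq_iff hGne, hG, ← integral_const_mul]
    congr 1
    ext v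
    rw [phaseVariance_eq_add hTY, ← Complex.ofReal_mul, ← Real.exp_add]
    congr 2; ring
  rw [← hlim]
  have key := ((tendsto_integral_cellKernel hT hY h hd hd0).div
    (tendsto_integral_cellKernel hT (by simp) h.zero hd hd0) hGne).mono_left
    (inf_le_left : atTop ⊓ 𝓟 {m : ℕ | Odd m} ≤ atTop)
  refine key.congr' ?_
  have hd' := hd.filter_mono (inf_le_left : atTop ⊓ 𝓟 {m : ℕ | Odd m} ≤ atTop)
  have hm' := (eventually_gt_atTop (0 : ℕ)).filter_mono
    (inf_le_left : atTop ⊓ 𝓟 {m : ℕ | Odd m} ≤ atTop)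
  have ho' : ∀ᶠ m in atTop ⊓ 𝓟 {m : ℕ | Odd m}, Odd m := eventually_inf_principal.2
    (Eventually.of_forall fun m hm => hm)
  filter_upwards [hd', hm', ho'] with m hdm hm ho
  have hsum : ∀ (ω : Fin m → Ω) (k : ι), Odd (∑ j, T (ω j) k) := fun ω k => by
    have h2 : (2 : ℤ) ∣ ∑ j, (T (ω j) k - 1) :=
      Finset.dvd_sum fun j _ => ((hodd (ω j) k).sub_odd odd_one).two_dvd
    rw [Finset.sum_sub_distrib, Finset.sum_const, Finset.card_univ, Fintype.card_fin,
      nsmul_one] at h2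
    simpa using (even_iff_two_dvd.2 h2).add_odd (show Odd (m : ℤ) by exact_mod_cast ho)
  have hs : (√(m : ℝ) : ℂ) ≠ 0 := by
    exact_mod_cast (Real.sqrt_pos.2 (by exact_mod_cast hm : (0 : ℝ) < m)).ne'
  have hN : ((oddWindow (d m)).card : ℂ) ≠ 0 := by exact_mod_cast hdm.card_pos.ne'
  have hc : (Fintype.card Ω : ℂ) ≠ 0 := by exact_mod_cast Fintype.card_ne_zero
  have hp : (Real.pi : ℂ) ≠ 0 := by exact_mod_cast Real.pi_ne_zero
  have e1 := sum_window_cexp_eq_integral T ((√(m : ℝ))⁻¹ • Y) (d m) hsum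
  have e2 := sum_window_cexp_eq_integral T ((√(m : ℝ))⁻¹ • (0 : Ω → ℝ)) (d m) hsum
  rw [integral_cellKernel_rescale _ _ hm hdm] at e1 e2
  simp only [Pi.smul_apply, smul_eq_mul, Pi.zero_apply, mul_zero, Finset.sum_const_zero,
    Complex.ofReal_zero, Complex.exp_zero] at e1 e2
  rw [e1, e2, ← mul_assoc, ← mul_assoc, mul_div_mul_left _ _ (by positivity)]
  rfl

end ConditionalCLT

section Triplets

/-- The vote of a voter in the election of `k` against `k + 1`. -/
def pairVote (σ : Ranking) (k : Fin 3) : ℤ := if σ k < σ (k + 1) then 1 else -1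

/-- The sum of the votes of a triplet of voters. -/
def tripletSum (τ : Fin 3 → Ranking) (k : Fin 3) : ℤ :=
  pairVote (τ 0) k + pairVote (τ 1) k + pairVote (τ 2) k

/-- The product of the votes of a triplet of voters. -/
def tripletProd (τ : Fin 3 → Ranking) (k : Fin 3) : ℤ :=
  pairVote (τ 0) k * pairVote (τ 1) k * pairVote (τ 2) k

lemma pairVote_eq (σ : Ranking) (k : Fin 3) : pairVote σ k = 1 ∨ pairVote σ k = -1 := by
  unfold pairVote; split_ifs <;> simp

lemma odd_tripletSum (τ : Fin 3 → Ranking) (k : Fin 3) : Odd (tripletSum τ k) := by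
  unfold tripletSum
  rcases pairVote_eq (τ 0) k with h0 | h0 <;> rcases pairVote_eq (τ 1) k with h1 | h1 <;>
    rcases pairVote_eq (τ 2) k with h2 | h2 <;> rw [h0, h1, h2] <;> decide

lemma two_mul_sign_tripletSum (τ : Fin 3 → Ranking) (k : Fin 3) :
    2 * Int.sign (tripletSum τ k) = tripletSum τ k - tripletProd τ k := by
  unfold tripletSum tripletProd
  rcases pairVote_eq (τ 0) k with h0 | h0 <;> rcases pairVote_eq (τ 1) k with h1 | h1 <;>
    rcases pairVote_eq (τ 2) k with h2 | h2 <;> rw [h0, h1, h2] <;> decide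

lemma sum_tripletSum : ∀ k, ∑ τ, tripletSum τ k = 0 := by decide +kernel

lemma sum_tripletProd : ∀ k, ∑ τ, tripletProd τ k = 0 := by decide +kernel

lemma sum_tripletSum_mul_tripletProd :
    ∀ k l, ∑ τ, tripletSum τ k * tripletProd τ l = 0 := by decide +kernel

lemma sum_tripletProd_mul_tripletProd :
    ∀ k l, ∑ τ, tripletProd τ k * tripletProd τ l = if k = l then 216 else -8 := by decide +kernel

lemma exists_pairVote_flip : ∀ k : Fin 3, ∃ a b : Ranking,
    pairVote a k = 1 ∧ pairVote b k = -1 ∧ ∀ l, l ≠ k → pairVote a l = pairVote b l := by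
  decide +kernel

lemma norm_cexp_add_cexp_le (a b : ℝ) :
    ‖Complex.exp (Complex.I * a) + Complex.exp (Complex.I * b)‖
      ≤ 2 - Real.sin ((a - b) / 2) ^ 2 := by
  have h : Complex.exp (Complex.I * a) + Complex.exp (Complex.I * b)
      = Complex.exp (Complex.I * ((a + b) / 2 : ℝ)) * ((2 * Real.cos ((a - b) / 2) : ℝ) : ℂ) := by
    push_cast
    rw [Complex.two_cos, mul_add, ← Complex.exp_add, ← Complex.exp_add]
    congr 2 <;> ring
  rw [h, norm_mul, Complex.norm_exp_I_mul_ofReal, one_mul, Complex.norm_real, Real.norm_eq_abs,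
    abs_mul, abs_two, Real.sin_sq]
  nlinarith [sq_abs (Real.cos ((a - b) / 2)), sq_nonneg (|Real.cos ((a - b) / 2)| - 1)]

/-- Two outcomes with different phases make the characteristic function smaller than `1`. -/
lemma norm_phaseAverage_le {Ω ι : Type*} [Fintype Ω] [Fintype ι] (T : Ω → ι → ℤ) (Y : Ω → ℝ)
    (u : ι → ℝ) (τ τ' : Ω) {x : ℝ}
    (hx : (∑ k, u k * T τ k + Y τ) - (∑ k, u k * T τ' k + Y τ') = 2 * x) :
    ‖phaseAverage T Y u‖ ≤ 1 - (Fintype.card Ω : ℝ)⁻¹ * Real.sin x ^ 2 := by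
  classical
  have : Nonempty Ω := ⟨τ⟩
  by_cases hne : τ = τ'
  · have h0 : x = 0 := by subst hne; linarith [hx, sub_self (∑ k, u k * T τ k + Y τ)]
    simpa [h0] using norm_phaseAverage_le_one T Y u
  have hc : (0 : ℝ) < Fintype.card Ω := by exact_mod_cast Fintype.card_pos
  have hcard : (Finset.univ.erase τ |>.erase τ').card + 2 = Fintype.card Ω := by
    have h1 := Finset.card_erase_add_one (Finset.mem_univ τ)
    have h2 := Finset.card_erase_add_one (s := Finset.univ.erase τ) (a := τ')
      (by simp [Ne.symm hne])
    rw [Finset.card_univ] at h1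
    omega
  have hcard' : ((Finset.univ.erase τ |>.erase τ').card : ℝ) + 2 = Fintype.card Ω := by
    exact_mod_cast hcard
  set f : Ω → ℂ := fun ω => Complex.exp (Complex.I * (∑ k, u k * T ω k + Y ω : ℝ)) with hf
  have hsum : ∑ ω, f ω = (f τ + f τ') + ∑ ω ∈ (Finset.univ.erase τ).erase τ', f ω := by
    rw [← Finset.add_sum_erase _ f (Finset.mem_univ τ), add_assoc,
      ← Finset.add_sum_erase (Finset.univ.erase τ) f (a := τ') (by simp [Ne.symm hne])]
  have hrest : ‖∑ ω ∈ (Finset.univ.erase τ).erase τ', f ω‖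
      ≤ ((Finset.univ.erase τ).erase τ').card := by
    refine (norm_sum_le _ _).trans_eq ?_
    simp_rw [hf, Complex.norm_exp_I_mul_ofReal]
    simp
  have hpair : ‖f τ + f τ'‖ ≤ 2 - Real.sin x ^ 2 := by
    have := norm_cexp_add_cexp_le (∑ k, u k * T τ k + Y τ) (∑ k, u k * T τ' k + Y τ')
    rwa [hx, mul_div_cancel_left₀ _ (two_ne_zero' ℝ)] at this
  rw [phaseAverage, norm_mul, norm_inv, Complex.norm_natCast, inv_mul_le_iff₀ hc, mul_sub, mul_one,
    mul_inv_cancel_left₀ hc.ne']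
  change ‖∑ ω, f ω‖ ≤ _
  rw [hsum]
  linarith [norm_add_le (f τ + f τ') (∑ ω ∈ (Finset.univ.erase τ).erase τ', f ω)]

lemma sq_le_sin_sq_add_sin_sq_of_nonneg {u t : ℝ} (hu0 : 0 ≤ u) (hu : u ≤ Real.pi / 2)
    (ht : |t| ≤ Real.pi / 8) : u ^ 2 / 50 ≤ Real.sin (2 * u) ^ 2 + Real.sin (u + t) ^ 2 := by
  have hpi := Real.pi_lt_d2
  have hpi0 := Real.pi_pos
  obtain ⟨ht1, ht2⟩ := abs_le.1 ht
  rcases le_total u (Real.pi / 4) with h | h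
  · have h1 := Real.mul_le_sin (x := 2 * u) (by linarith) (by linarith)
    have h2 : u ≤ 2 / Real.pi * (2 * u) := by
      rw [div_mul_eq_mul_div, le_div_iff₀ hpi0]
      nlinarith
    nlinarith [sq_nonneg (Real.sin (u + t))]
  · have h1 := Real.one_sub_sq_div_two_le_cos (x := Real.pi / 2 - (u + t))
    rw [Real.cos_pi_div_two_sub] at h1
    have h2 : (Real.pi / 2 - (u + t)) ^ 2 ≤ (3 * Real.pi / 8) ^ 2 :=
      sq_le_sq' (by linarith) (by linarith)
    have h3 : 3 / 10 ≤ Real.sin (u + t) := by nlinarith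
    nlinarith [sq_nonneg (Real.sin (2 * u))]

lemma sq_le_sin_sq_add_sin_sq {u t : ℝ} (hu : |u| ≤ Real.pi / 2) (ht : |t| ≤ Real.pi / 8) :
    u ^ 2 / 50 ≤ Real.sin (2 * u) ^ 2 + Real.sin (u + t) ^ 2 := by
  obtain ⟨hu1, hu2⟩ := abs_le.1 hu
  rcases le_total 0 u with h | h
  · exact sq_le_sin_sq_add_sin_sq_of_nonneg h hu2 ht
  · have := sq_le_sin_sq_add_sin_sq_of_nonneg (u := -u) (t := -t) (by linarith) (by linarith)
      (by rwa [abs_neg])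
    rw [mul_neg, Real.sin_neg, ← neg_add, Real.sin_neg] at this
    simpa using this

/-- A linear combination of the products of the votes of a triplet. -/
def prodPhase (θ : Fin 3 → ℝ) (τ : Fin 3 → Ranking) : ℝ := ∑ k, θ k * tripletProd τ k

lemma phase_sub_phase (u θ : Fin 3 → ℝ) (s : ℝ) (τ τ' : Fin 3 → Ranking) (k : Fin 3)
    (h : ∀ l, l ≠ k → tripletSum τ l = tripletSum τ' l ∧ tripletProd τ l = tripletProd τ' l) :
    (∑ l, u l * tripletSum τ l + (s • prodPhase θ) τ)
      - (∑ l, u l * tripletSum τ' l + (s • prodPhase θ) τ')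
      = u k * (tripletSum τ k - tripletSum τ' k : ℤ)
        + s * θ k * (tripletProd τ k - tripletProd τ' k : ℤ) := by
  simp only [prodPhase, Pi.smul_apply, smul_eq_mul]
  rw [add_sub_add_comm, ← mul_sub, ← Finset.sum_sub_distrib, ← Finset.sum_sub_distrib,
    Finset.sum_eq_single k, Finset.sum_eq_single k]
  · push_cast; ring
  · intro l _ hl; rw [(h l hl).2, sub_self]
  · simp
  · intro l _ hl; rw [(h l hl).1, sub_self]
  · simp

lemma norm_phaseAverage_triplet_le (u θ : Fin 3 → ℝ) (s : ℝ) (k : Fin 3)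
    (hu : |u k| ≤ Real.pi / 2) (ht : |s * θ k| ≤ Real.pi / 8) :
    ‖phaseAverage tripletSum (s • prodPhase θ) u‖ ≤ 1 - u k ^ 2 / 21600 := by
  obtain ⟨a, b, ha, hb, hab⟩ := exists_pairVote_flip k
  have h1 := norm_phaseAverage_le tripletSum (s • prodPhase θ) u ![a, a, a] ![a, b, b]
    (x := 2 * u k) (by
      rw [phase_sub_phase u θ s _ _ k]
      · simp [tripletSum, tripletProd, ha, hb]; ring
      · intro l hl; simp [tripletSum, tripletProd, hab l hl])
  have h2 := norm_phaseAverage_le tripletSum (s • prodPhase θ) u ![a, b, b] ![b, b, b]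
    (x := u k + s * θ k) (by
      rw [phase_sub_phase u θ s _ _ k]
      · simp [tripletSum, tripletProd, ha, hb]; ring
      · intro l hl; simp [tripletSum, tripletProd, hab l hl])
  have hcard : (Fintype.card (Fin 3 → Ranking) : ℝ) = 216 := by
    simp [Fintype.card_perm, Nat.factorial]
  rw [hcard] at h1 h2
  have h3 := sq_le_sin_sq_add_sin_sq hu ht
  linarith

lemma phaseDecay_triplet (θ : Fin 3 → ℝ) : PhaseDecay tripletSum (prodPhase θ) := by
  refine ⟨1 / 64800, by norm_num, ?_⟩
  have hθ : ∀ᶠ s in 𝓝 (0 : ℝ), ∀ k, |s * θ k| ≤ Real.pi / 8 := by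
    refine eventually_all.2 fun k => ?_
    have h : Tendsto (fun s : ℝ => |s * θ k|) (𝓝 0) (𝓝 |0 * θ k|) :=
      Continuous.tendsto (by fun_prop) 0
    rw [zero_mul, abs_zero] at h
    exact h.eventually_le_const (by positivity)
  filter_upwards [hθ] with s hs u hu
  have h := fun k => norm_phaseAverage_triplet_le u θ s k (hu k) (hs k)
  have h0 := h 0
  have h1 := h 1
  have h2 := h 2
  refine le_trans ?_ (Real.add_one_le_exp _)
  rw [Fin.sum_univ_three]
  linarith

end Triplets

section GaussianSector

lemma integral_indicator_lt_cos {κ : ℝ} (h1 : -1 ≤ κ) (h2 : κ ≤ 1) :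
    ∫ φ in (-Real.pi)..Real.pi, {φ | κ < Real.cos φ}.indicator (1 : ℝ → ℝ) φ
      = 2 * Real.arccos κ := by
  have hpi := Real.pi_pos
  have e : Set.Ioc (-Real.pi) Real.pi ∩ {φ | κ < Real.cos φ}
      = Set.Ioo (-Real.arccos κ) (Real.arccos κ) := by
    ext φ
    simp only [Set.mem_inter_iff, Set.mem_Ioc, Set.mem_ofPred_eq, Set.mem_Ioo]
    rw [← abs_lt]
    have key : |φ| ≤ Real.pi → (κ < Real.cos φ ↔ |φ| < Real.arccos κ) := by
      intro hφ
      rw [← Real.strictAntiOn_cos.lt_iff_gt (a := Real.arccos κ) (b := |φ|)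
        ⟨Real.arccos_nonneg κ, Real.arccos_le_pi κ⟩ ⟨abs_nonneg φ, hφ⟩, Real.cos_arccos h1 h2,
        Real.cos_abs]
    constructor
    · rintro ⟨⟨ha, hb⟩, hc⟩
      exact (key (abs_le.2 ⟨ha.le, hb⟩)).1 hc
    · intro h
      have h3 := Real.arccos_le_pi κ
      obtain ⟨ha, hb⟩ := abs_lt.1 h
      exact ⟨⟨by linarith, by linarith⟩, (key (h.le.trans h3)).2 h⟩
  have hm : MeasurableSet {φ : ℝ | κ < Real.cos φ} :=
    measurableSet_lt measurable_const Real.measurable_cos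
  rw [intervalIntegral.integral_of_le (by linarith), setIntegral_indicator hm, e]
  simp only [Pi.one_apply, setIntegral_const, smul_eq_mul, mul_one]
  rw [Real.volume_real_Ioo_of_le (by linarith [Real.arccos_nonneg κ])]
  ring

lemma integral_indicator_lt_cos_two_mul {κ : ℝ} (h1 : -1 ≤ κ) (h2 : κ ≤ 1) :
    ∫ φ in Set.Ioo (-Real.pi) Real.pi, {φ | κ < Real.cos (2 * φ)}.indicator (1 : ℝ → ℝ) φ
      = 2 * Real.arccos κ := by
  have hpi := Real.pi_pos
  set g : ℝ → ℝ := {φ | κ < Real.cos φ}.indicator (1 : ℝ → ℝ) with hg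
  have hper : Function.Periodic g (2 * Real.pi) := by
    intro φ; simp [hg, Set.indicator]
  have e : ∀ φ, {φ | κ < Real.cos (2 * φ)}.indicator (1 : ℝ → ℝ) φ = g (2 * φ) := by
    intro φ; simp [hg, Set.indicator]
  simp_rw [e]
  rw [← integral_Ioc_eq_integral_Ioo, ← intervalIntegral.integral_of_le (by linarith),
    intervalIntegral.integral_comp_mul_left _ two_ne_zero]
  have hint : ∀ a b : ℝ, IntervalIntegrable g volume a b := by
    intro a b
    have hm : MeasurableSet {φ : ℝ | κ < Real.cos φ} :=
      measurableSet_lt measurable_const Real.measurable_cos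
    refine (intervalIntegrable_const (c := (1 : ℝ))).mono_fun
      ((measurable_one.indicator hm).aestronglyMeasurable) (ae_of_all _ fun φ => ?_)
    simp only [hg, Set.indicator]
    split_ifs <;> simp
  have h3 := hper.intervalIntegral_add_eq (2 * -Real.pi) (-Real.pi)
  have h4 := hper.intervalIntegral_add_eq 0 (-Real.pi)
  rw [show 2 * -Real.pi + 2 * Real.pi = 0 by ring, show -Real.pi + 2 * Real.pi = Real.pi by ring,
    integral_indicator_lt_cos h1 h2] at h3
  rw [zero_add, show -Real.pi + 2 * Real.pi = Real.pi by ring,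
    integral_indicator_lt_cos h1 h2] at h4
  rw [← intervalIntegral.integral_add_adjacent_intervals (hint _ 0) (hint 0 _), h3, h4, smul_eq_mul]
  ring

lemma integral_mul_exp_neg_half_sq :
    ∫ r in Set.Ioi (0 : ℝ), r * Real.exp (-r ^ 2 / 2) = 1 := by
  have h := integral_mul_cexp_neg_mul_sq (b := 1 / 2) (by norm_num)
  have e : ∀ r : ℝ, (r : ℂ) * Complex.exp (-(1 / 2) * (r : ℂ) ^ 2)
      = ((r * Real.exp (-r ^ 2 / 2) : ℝ) : ℂ) := by
    intro r; push_cast; congr 2; ring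
  simp_rw [e] at h
  rw [integral_complex_ofReal] at h
  have h' : ((∫ r in Set.Ioi (0 : ℝ), r * Real.exp (-r ^ 2 / 2) : ℝ) : ℂ) = ((1 : ℝ) : ℂ) := by
    rw [h]; norm_num
  exact_mod_cast h'

/-- The double sector `κ (x² + y²) < x² - y²` of the plane. -/
def sector (κ : ℝ) : Set (ℝ × ℝ) := {p | κ * (p.1 ^ 2 + p.2 ^ 2) < p.1 ^ 2 - p.2 ^ 2}

lemma measurableSet_sector (κ : ℝ) : MeasurableSet (sector κ) :=
  measurableSet_lt (by fun_prop) (by fun_prop)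

/-- The standard normal law of the plane gives each sector its share of the full angle. -/
theorem gaussianReal_prod_sector {κ : ℝ} (h1 : -1 ≤ κ) (h2 : κ ≤ 1) :
    ((gaussianReal 0 1).prod (gaussianReal 0 1)).real (sector κ) = Real.arccos κ / Real.pi := by
  have hpi := Real.pi_pos
  set g : ℝ × ℝ → ℝ := fun p => (2 * Real.pi)⁻¹ * Real.exp (-(p.1 ^ 2 + p.2 ^ 2) / 2) with hg
  have hdens : ∀ p : ℝ × ℝ, gaussianPDF 0 1 p.1 * gaussianPDF 0 1 p.2 = ENNReal.ofReal (g p) := by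
    intro p
    rw [gaussianPDF, gaussianPDF, ← ENNReal.ofReal_mul (gaussianPDFReal_nonneg _ _ _)]
    congr 1
    simp only [gaussianPDFReal, hg, NNReal.coe_one, mul_one, sub_zero]
    rw [mul_mul_mul_comm, ← mul_inv, Real.mul_self_sqrt (by positivity), ← Real.exp_add]
    congr 2; ring
  have hg0 : ∀ p, 0 ≤ g p := fun p => by positivity
  have hgm : Measurable g := by fun_prop
  have step1 : ((gaussianReal 0 1).prod (gaussianReal 0 1)).real (sector κ)
      = ∫ p in sector κ, g p := by
    rw [gaussianReal_of_var_ne_zero 0 one_ne_zero, prod_withDensity₀ (by fun_prop) (by fun_prop),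
      measureReal_def, withDensity_apply _ (measurableSet_sector κ),
      integral_eq_lintegral_of_nonneg_ae (ae_of_all _ hg0) hgm.aestronglyMeasurable]
    simp_rw [hdens]
    rfl
  rw [step1, ← integral_indicator (measurableSet_sector κ), ← integral_comp_polarCoord_symm,
    polarCoord_target]
  have step2 : ∀ p ∈ Set.Ioi (0 : ℝ) ×ˢ Set.Ioo (-Real.pi) Real.pi,
      p.1 • (sector κ).indicator g (polarCoord.symm p)
        = (p.1 * Real.exp (-p.1 ^ 2 / 2)) *
          ((2 * Real.pi)⁻¹ * {φ | κ < Real.cos (2 * φ)}.indicator (1 : ℝ → ℝ) p.2) := by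
    rintro ⟨r, φ⟩ ⟨hr, -⟩
    have hr : 0 < r := hr
    have hsq : (r * Real.cos φ) ^ 2 + (r * Real.sin φ) ^ 2 = r ^ 2 := by
      rw [mul_pow, mul_pow, ← mul_add, Real.cos_sq_add_sin_sq, mul_one]
    have hmem : polarCoord.symm (r, φ) ∈ sector κ ↔ κ < Real.cos (2 * φ) := by
      simp only [polarCoord_symm_apply, sector, Set.mem_ofPred_eq, hsq]
      rw [show (r * Real.cos φ) ^ 2 - (r * Real.sin φ) ^ 2 = Real.cos (2 * φ) * r ^ 2 by
        rw [Real.cos_two_mul']; ring]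
      exact mul_lt_mul_iff_left₀ (by positivity)
    simp only [Set.indicator, hmem, Set.mem_ofPred_eq]
    split_ifs
    · simp only [hg, polarCoord_symm_apply, hsq, smul_eq_mul, Pi.one_apply]; ring
    · simp
  rw [setIntegral_congr_fun (measurableSet_Ioi.prod measurableSet_Ioo) step2, Measure.volume_eq_prod,
    setIntegral_prod_mul (fun r => r * Real.exp (-r ^ 2 / 2)) (fun φ => (2 * Real.pi)⁻¹ *
      {φ | κ < Real.cos (2 * φ)}.indicator (1 : ℝ → ℝ) φ), integral_mul_exp_neg_half_sq,
    integral_const_mul, integral_indicator_lt_cos_two_mul h1 h2]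
  field_simp

lemma gaussianReal_prod_sector_boundary {κ : ℝ} (h1 : -1 < κ) :
    ((gaussianReal 0 1).prod (gaussianReal 0 1))
      {p | κ * (p.1 ^ 2 + p.2 ^ 2) = p.1 ^ 2 - p.2 ^ 2} = 0 := by
  have hm : MeasurableSet {p : ℝ × ℝ | κ * (p.1 ^ 2 + p.2 ^ 2) = p.1 ^ 2 - p.2 ^ 2} :=
    measurableSet_eq_fun (by fun_prop) (by fun_prop)
  rw [Measure.measure_prod_null hm]
  have := nullSingletonClass_gaussianReal (μ := 0) one_ne_zero
  refine ae_of_all _ fun x => ?_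
  refine Set.Finite.measure_zero (Set.Finite.subset (s := {√((1 - κ) * x ^ 2 / (1 + κ)),
    -√((1 - κ) * x ^ 2 / (1 + κ))}) (by simp) ?_) _
  intro y hy
  have hy : κ * (x ^ 2 + y ^ 2) = x ^ 2 - y ^ 2 := hy
  have h3 : (1 - κ) * x ^ 2 / (1 + κ) = y ^ 2 := by
    rw [div_eq_iff (by linarith)]; linarith
  rw [h3, Real.sqrt_sq_eq_abs]
  rcases abs_cases y with ⟨h, _⟩ | ⟨h, _⟩ <;> simp [h]

/-- The standard normal law of the Euclidean plane in terms of that of `ℝ × ℝ`. -/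
lemma stdGaussian_apply {s : Set (ℝ × ℝ)} (hs : MeasurableSet s) :
    stdGaussian (EuclideanSpace ℝ (Fin 2)) {x | (x 0, x 1) ∈ s}
      = ((gaussianReal 0 1).prod (gaussianReal 0 1)) s := by
  have hm : MeasurableSet {x : EuclideanSpace ℝ (Fin 2) | (x 0, x 1) ∈ s} :=
    (by fun_prop : Measurable fun x : EuclideanSpace ℝ (Fin 2) => (x 0, x 1)) hs
  rw [← map_pi_eq_stdGaussian, Measure.map_apply (by fun_prop) hm, ← (measurePreserving_finTwoArrow (gaussianReal 0 1)).measure_preimage hs.nullMeasurableSet]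
  rfl

end GaussianSector

section FiniteLaws

/-- Lévy's theorem and the portmanteau theorem for uniform laws on finite sets: if the
characteristic functions of `X` on `s n` converge, so do the proportions of a continuity set. -/
theorem tendsto_card_filter_div_card {E : Type*} [NormedAddCommGroup E] [InnerProductSpace ℝ E]
    [FiniteDimensional ℝ E] [MeasurableSpace E] [BorelSpace E] {Ω : ℕ → Type*}
    [∀ n, Fintype (Ω n)]
    (s : ∀ n, Finset (Ω n)) (X : ∀ n, Ω n → E) (μ₀ : ProbabilityMeasure E)
    (hs : ∀ᶠ n in atTop, (s n).Nonempty)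
    (h : ∀ t, Tendsto (fun n => (∑ ω ∈ s n, Complex.exp (Complex.I * (inner ℝ (X n ω) t : ℝ))) /
      (s n).card) atTop (𝓝 (charFun (μ₀ : Measure E) t)))
    {S : Set E} (hS : MeasurableSet S) (hfr : (μ₀ : Measure E) (frontier S) = 0)
    [∀ n, DecidablePred fun ω => X n ω ∈ S] :
    Tendsto (fun n => (((s n).filter fun ω => X n ω ∈ S).card : ℝ) / (s n).card) atTop
      (𝓝 ((μ₀ : Measure E).real S)) := by
  classical
  let law : ∀ n, (s n).Nonempty → PMF E := fun n hn => (PMF.uniformOfFinset (s n) hn).map (X n)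
  let μ : ℕ → ProbabilityMeasure E := fun n =>
    if hn : (s n).Nonempty then ⟨(law n hn).toMeasure, inferInstance⟩ else μ₀
  have hchar : ∀ n, (hn : (s n).Nonempty) → ∀ t, charFun (μ n : Measure E) t =
      (∑ ω ∈ s n, Complex.exp (Complex.I * (inner ℝ (X n ω) t : ℝ))) / (s n).card := by
    intro n hn t
    let _ : MeasurableSpace (Ω n) := ⊤
    have hμ : (μ n : Measure E) = (PMF.uniformOfFinset (s n) hn).toMeasure.map (X n) := by
      rw [show μ n = ⟨(law n hn).toMeasure, inferInstance⟩ from dif_pos hn]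
      exact (PMF.toMeasure_map (f := X n) (PMF.uniformOfFinset (s n) hn) measurable_from_top).symm
    rw [hμ, charFun_apply, integral_map measurable_from_top.aemeasurable (by fun_prop)]
    have : DiscreteMeasurableSpace (Ω n) := ⟨fun _ => MeasurableSpace.measurableSet_top⟩
    rw [PMF.integral_eq_sum, Finset.sum_div, ← Finset.sum_subset (Finset.subset_univ (s n))]
    · refine Finset.sum_congr rfl fun ω hω => ?_
      rw [PMF.uniformOfFinset_apply_of_mem _ hω, ENNReal.toReal_inv, ENNReal.toReal_natCast,
        Complex.real_smul, mul_comm Complex.I, div_eq_inv_mul]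
      push_cast
      rfl
    · intro ω _ hω
      rw [PMF.uniformOfFinset_apply_of_notMem _ hω]
      simp
  have hreal : ∀ n, (hn : (s n).Nonempty) → (μ n : Measure E).real S =
      (((s n).filter fun ω => X n ω ∈ S).card : ℝ) / (s n).card := by
    intro n hn
    let _ : MeasurableSpace (Ω n) := ⊤
    have hμ : (μ n : Measure E) = (PMF.uniformOfFinset (s n) hn).toMeasure.map (X n) := by
      rw [show μ n = ⟨(law n hn).toMeasure, inferInstance⟩ from dif_pos hn]
      exact (PMF.toMeasure_map (f := X n) (PMF.uniformOfFinset (s n) hn) measurable_from_top).symm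
    rw [hμ, measureReal_def, Measure.map_apply measurable_from_top hS,
      PMF.toMeasure_uniformOfFinset_apply _ _ MeasurableSpace.measurableSet_top]
    simp
  have hlim : Tendsto μ atTop (𝓝 μ₀) := by
    refine ProbabilityMeasure.tendsto_of_tendsto_charFun fun t => (h t).congr' ?_
    filter_upwards [hs] with n hn using (hchar n hn t).symm
  have h1 := ProbabilityMeasure.tendsto_measure_of_null_frontier_of_tendsto' hlim hfr
  have h2 := (ENNReal.tendsto_toReal (measure_ne_top (μ₀ : Measure E) S)).comp h1
  refine h2.congr' ?_
  filter_upwards [hs] with n hn using hreal n hn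

/-- The impartial culture gives all profiles the same probability. -/
lemma impartialCulture_eq_uniformOn (n : ℕ) : impartialCulture n = uniformOn Set.univ := by
  refine Measure.ext_of_singleton fun r => ?_
  rw [impartialCulture, Measure.pi_singleton]
  simp_rw [uniformOn_univ, Measure.count_singleton]
  simp [ENNReal.inv_pow]

lemma cond_impartialCulture_real (n : ℕ) (A B : Set (Fin n → Ranking)) :
    (cond (impartialCulture n) A).real B = ((A ∩ B).ncard : ℝ) / A.ncard := by
  rw [impartialCulture_eq_uniformOn, uniformOn, cond_cond_eq_cond_inter' .univ .of_discrete
    (by simp [Measure.count_univ]), Set.univ_inter, measureReal_def, cond_apply .of_discrete]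
  have hA : Measure.count A = (A.ncard : ENNReal) := by
    rw [Measure.count_apply_finite _ (Set.toFinite A), Set.ncard_eq_toFinset_card A]
  have hB : Measure.count (A ∩ B) = ((A ∩ B).ncard : ENNReal) := by
    rw [Measure.count_apply_finite _ (Set.toFinite _), Set.ncard_eq_toFinset_card (A ∩ B)]
  rw [hA, hB]
  simp [div_eq_inv_mul]

end FiniteLaws

section Profiles

/-- The profiles of `3 m` voters as profiles of `m` triplets. -/
def groupTriplets (m : ℕ) : (Fin m → Fin 3 → Ranking) ≃ (Fin (3 * m) → Ranking) :=
  (Equiv.curry (Fin m) (Fin 3) Ranking).symm.trans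
    (Equiv.arrowCongr (finProdFinEquiv.trans (finCongr (mul_comm m 3))) (Equiv.refl _))

lemma groupTriplets_symm_apply {m : ℕ} (r : Fin (3 * m) → Ranking) (j : Fin m) (i : Fin 3) :
    (groupTriplets m).symm r j i = r ⟨3 * j + i, by omega⟩ := by
  change r _ = r _
  congr 1
  ext
  simp [finProdFinEquiv, add_comm]

lemma votes_succ_eq {n : ℕ} (r : Fin n → Ranking) (k : Fin 3) (i : Fin n) :
    votes r k (k + 1) i = pairVote (r i) k := rfl

lemma votes_swap {n : ℕ} (r : Fin n → Ranking) {k l : Fin 3} (h : k ≠ l) (i : Fin n) :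
    votes r l k i = -votes r k l i := by
  have : r i k ≠ r i l := fun he => h ((r i).injective he)
  unfold votes
  rcases lt_or_gt_of_ne this with h | h <;> simp [h, h.not_gt]

lemma sum_votes_succ {m : ℕ} (r : Fin (3 * m) → Ranking) (k : Fin 3) :
    ∑ i, votes r k (k + 1) i = ∑ j, tripletSum ((groupTriplets m).symm r j) k := by
  rw [← (finProdFinEquiv.trans (finCongr (mul_comm m 3))).sum_comp, Fintype.sum_prod_type]
  refine Finset.sum_congr rfl fun j _ => ?_
  rw [Fin.sum_univ_three]
  rfl

lemma tripletMajority_votes_succ {m : ℕ} (r : Fin (3 * m) → Ranking) (k : Fin 3) :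
    tripletMajority (votes r k (k + 1))
      = Int.sign (∑ j, Int.sign (tripletSum ((groupTriplets m).symm r j) k)) := by
  simp only [tripletMajority, tripletSum, groupTriplets_symm_apply, votes_succ_eq]
  rfl

/-- The profiles of triplets for which the three elections are `d`-close. -/
def closeProfiles (m : ℕ) (d : ℝ) : Finset (Fin m → Fin 3 → Ranking) :=
  Finset.univ.filter fun ω => ∀ k, |((∑ j, tripletSum (ω j) k : ℤ) : ℝ)| ≤ d

lemma mem_closeElections_iff {m : ℕ} {d : ℝ} (r : Fin (3 * m) → Ranking) :
    r ∈ closeElections (3 * m) d ↔ (groupTriplets m).symm r ∈ closeProfiles m d := by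
  rw [closeProfiles, Finset.mem_filter]
  simp only [Finset.mem_univ, true_and, ← sum_votes_succ]
  constructor
  · exact fun h k => h k (k + 1) (by fin_cases k <;> decide)
  · intro h k l hkl
    rcases (by decide +revert : l = k + 1 ∨ k = l + 1) with rfl | rfl
    · exact h k
    · have : ∑ i, votes r (l + 1) l i = -∑ i, votes r l (l + 1) i := by
        rw [← Finset.sum_neg_distrib]
        exact Finset.sum_congr rfl fun i _ => votes_swap r hkl.symm i
      rw [this, Int.cast_neg, abs_neg]
      exact h l

/-- The sum over the triplets of twice the decision of the triplet. -/
def levelSum {m : ℕ} (ω : Fin m → Fin 3 → Ranking) (k : Fin 3) : ℤ :=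
  ∑ j, 2 * Int.sign (tripletSum (ω j) k)

lemma levelSum_eq_sub {m : ℕ} (ω : Fin m → Fin 3 → Ranking) (k : Fin 3) :
    levelSum ω k = ∑ j, tripletSum (ω j) k - ∑ j, tripletProd (ω j) k := by
  rw [levelSum, ← Finset.sum_sub_distrib]
  exact Finset.sum_congr rfl fun j _ => two_mul_sign_tripletSum _ _

lemma sign_levelSum {m : ℕ} (ω : Fin m → Fin 3 → Ranking) (k : Fin 3) :
    Int.sign (levelSum ω k) = Int.sign (∑ j, Int.sign (tripletSum (ω j) k)) := by
  rw [levelSum, ← Finset.mul_sum, Int.sign_mul]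
  exact one_mul _

lemma levelSum_ne_zero {m : ℕ} (hm : Odd m) (ω : Fin m → Fin 3 → Ranking) (k : Fin 3) :
    levelSum ω k ≠ 0 := by
  have hodd : Odd (∑ j, Int.sign (tripletSum (ω j) k)) := by
    have h2 : (2 : ℤ) ∣ ∑ j, (Int.sign (tripletSum (ω j) k) - 1) := by
      refine Finset.dvd_sum fun j _ => ?_
      have hne : tripletSum (ω j) k ≠ 0 := fun h0 => by
        have := odd_tripletSum (ω j) k
        rw [h0] at this
        exact absurd this (by decide)
      rcases lt_or_gt_of_ne hne with h | h
      · rw [Int.sign_eq_neg_one_of_neg h]; decide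
      · rw [Int.sign_eq_one_of_pos h]; decide
    rw [Finset.sum_sub_distrib, Finset.sum_const, Finset.card_univ, Fintype.card_fin,
      nsmul_one] at h2
    simpa using (even_iff_two_dvd.2 h2).add_odd (show Odd (m : ℤ) by exact_mod_cast hm)
  rw [levelSum, ← Finset.mul_sum]
  refine mul_ne_zero two_ne_zero fun h0 => ?_
  rw [h0] at hodd
  exact absurd hodd (by decide)

lemma sign_eq_sign_iff {a b : ℤ} (ha : a ≠ 0) (hb : b ≠ 0) :
    a.sign = b.sign ↔ 0 < a * b := by
  rcases lt_or_gt_of_ne ha with h | h <;> rcases lt_or_gt_of_ne hb with h' | h'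
  · simp [Int.sign_eq_neg_one_of_neg h, Int.sign_eq_neg_one_of_neg h', mul_pos_of_neg_of_neg h h']
  · simp [Int.sign_eq_neg_one_of_neg h, Int.sign_eq_one_of_pos h', (mul_neg_of_neg_of_pos h h').le]
  · simp [Int.sign_eq_one_of_pos h, Int.sign_eq_neg_one_of_neg h', (mul_neg_of_pos_of_neg h h').le]
  · simp [Int.sign_eq_one_of_pos h, Int.sign_eq_one_of_pos h', mul_pos h h']

/-- The proportion of the close profiles for which the elections `k` and `l` agree. -/
def agreement (m : ℕ) (d : ℝ) (k l : Fin 3) : ℝ :=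
  (((closeProfiles m d).filter fun ω => 0 < levelSum ω k * levelSum ω l).card : ℝ)
    / (closeProfiles m d).card

/-- The conditional probability of the paradox in terms of the pairwise agreements. -/
lemma cond_condorcetParadox_eq {m : ℕ} (hm : Odd m) {d : ℝ} (hd : (closeProfiles m d).Nonempty) :
    (cond (impartialCulture (3 * m)) (closeElections (3 * m) d)).real (condorcetParadox m)
      = (agreement m d 0 1 + agreement m d 1 2 + agreement m d 2 0 - 1) / 2 := by
  classical
  have hN : ((closeProfiles m d).card : ℝ) ≠ 0 := by exact_mod_cast hd.card_pos.ne'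
  have hP : ∀ r, r ∈ condorcetParadox m ↔
      0 < levelSum ((groupTriplets m).symm r) 0 * levelSum ((groupTriplets m).symm r) 1 ∧
      0 < levelSum ((groupTriplets m).symm r) 1 * levelSum ((groupTriplets m).symm r) 2 := by
    intro r
    have h0 := tripletMajority_votes_succ r 0
    have h1 := tripletMajority_votes_succ r 1
    have h2 := tripletMajority_votes_succ r 2
    rw [← sign_levelSum] at h0 h1 h2
    rw [← sign_eq_sign_iff (levelSum_ne_zero hm _ _) (levelSum_ne_zero hm _ _),
      ← sign_eq_sign_iff (levelSum_ne_zero hm _ _) (levelSum_ne_zero hm _ _), ← h0, ← h1, ← h2]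
    rfl
  have hE : (closeElections (3 * m) d).ncard = (closeProfiles m d).card := by
    rw [← Set.ncard_coe_finset, ← Set.ncard_image_of_injective _ (groupTriplets m).injective]
    congr 1
    ext r
    rw [mem_closeElections_iff, (groupTriplets m).image_eq_preimage_symm]
    rfl
  have hEP : (closeElections (3 * m) d ∩ condorcetParadox m).ncard
      = ((closeProfiles m d).filter fun ω => 0 < levelSum ω 0 * levelSum ω 1 ∧
        0 < levelSum ω 1 * levelSum ω 2).card := by
    rw [← Set.ncard_coe_finset, ← Set.ncard_image_of_injective _ (groupTriplets m).injective]
    congr 1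
    ext r
    rw [Set.mem_inter_iff, mem_closeElections_iff, hP, (groupTriplets m).image_eq_preimage_symm]
    simp
  rw [cond_impartialCulture_real, hE, hEP, agreement, agreement, agreement]
  field_simp
  simp only [Finset.card_filter, Finset.card_eq_sum_ones (closeProfiles m d)]
  push_cast
  rw [Finset.sum_mul, ← Finset.sum_add_distrib, ← Finset.sum_add_distrib, ← Finset.sum_sub_distrib]
  refine Finset.sum_congr rfl fun ω _ => ?_
  have hne := levelSum_ne_zero hm ω
  rcases lt_or_gt_of_ne (hne 0) with h0 | h0 <;> rcases lt_or_gt_of_ne (hne 1) with h1 | h1 <;>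
    rcases lt_or_gt_of_ne (hne 2) with h2 | h2 <;>
    simp only [mul_pos_iff, h0, h1, h2, h0.not_gt, h1.not_gt, h2.not_gt] <;> norm_num

end Profiles

section Limit

lemma average_prodPhase_sq (θ : Fin 3 → ℝ) :
    (Fintype.card (Fin 3 → Ranking) : ℝ)⁻¹ * ∑ τ, prodPhase θ τ ^ 2
      = 28 / 27 * ∑ k, θ k ^ 2 - 1 / 27 * (∑ k, θ k) ^ 2 := by
  have hcard : (Fintype.card (Fin 3 → Ranking) : ℝ) = 216 := by
    simp [Fintype.card_perm, Nat.factorial]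
  have h : ∀ k l, ∑ τ, (tripletProd τ k : ℝ) * tripletProd τ l = if k = l then 216 else -8 := by
    intro k l
    exact_mod_cast sum_tripletProd_mul_tripletProd k l
  have e : ∑ τ, prodPhase θ τ ^ 2 = ∑ k, ∑ l, θ k * θ l * if k = l then 216 else -8 := by
    simp_rw [← h, prodPhase, sq, Finset.sum_mul_sum, Finset.mul_sum]
    rw [Finset.sum_comm]
    refine Finset.sum_congr rfl fun k _ => ?_
    rw [Finset.sum_comm]
    exact Finset.sum_congr rfl fun l _ => Finset.sum_congr rfl fun τ _ => by ring
  rw [hcard, e]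
  simp [Fin.sum_univ_three]
  ring

lemma sum_prodPhase (θ : Fin 3 → ℝ) : ∑ τ, prodPhase θ τ = 0 := by
  have h : ∀ k, ∑ τ, (tripletProd τ k : ℝ) = 0 := fun k => by exact_mod_cast sum_tripletProd k
  simp_rw [prodPhase]
  rw [Finset.sum_comm]
  simp_rw [← Finset.mul_sum, h]
  simp

lemma sum_tripletSum_mul_prodPhase (θ : Fin 3 → ℝ) (k : Fin 3) :
    ∑ τ, (tripletSum τ k : ℝ) * prodPhase θ τ = 0 := by
  have h : ∀ l, ∑ τ, (tripletSum τ k : ℝ) * tripletProd τ l = 0 := fun l => by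
    exact_mod_cast sum_tripletSum_mul_tripletProd k l
  simp_rw [prodPhase, Finset.mul_sum, mul_left_comm _ (θ _)]
  rw [Finset.sum_comm]
  simp_rw [← Finset.mul_sum, h]
  simp

lemma oddWindow_closeness_nonempty :
    ∀ᶠ m : ℕ in atTop, (oddWindow (closeness (3 * m))).Nonempty := by
  have h3 : Tendsto (fun m : ℕ => ((3 * m : ℕ) : ℝ)) atTop atTop :=
    tendsto_natCast_atTop_atTop.comp (tendsto_id.const_mul_atTop' (by norm_num))
  have h := (isLittleO_log_rpow_atTop (r := 1 / 2) (by norm_num)).bound (c := 1) one_pos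
  filter_upwards [h3.eventually h, h3.eventually_gt_atTop 1] with m hm hm1
  refine ⟨1, mem_oddWindow.2 ⟨?_, odd_one⟩⟩
  have hlog := Real.log_pos hm1
  rw [Real.norm_of_nonneg hlog.le, Real.norm_of_nonneg (by positivity), one_mul,
    ← Real.sqrt_eq_rpow] at hm
  rw [Int.cast_one, abs_one, closeness, one_le_div hlog]
  exact hm

lemma tendsto_inv_sqrt_mul_closeness :
    Tendsto (fun m : ℕ => (√(m : ℝ))⁻¹ * closeness (3 * m)) atTop (𝓝 0) := by
  have h3 : Tendsto (fun m : ℕ => ((3 * m : ℕ) : ℝ)) atTop atTop :=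
    tendsto_natCast_atTop_atTop.comp (tendsto_id.const_mul_atTop' (by norm_num))
  have h := ((tendsto_inv_atTop_zero.comp (Real.tendsto_log_atTop.comp h3)).const_mul √3)
  rw [mul_zero] at h
  refine h.congr' ?_
  filter_upwards [eventually_gt_atTop 0] with m hm
  have hs : √(m : ℝ) ≠ 0 := (Real.sqrt_pos.2 (by exact_mod_cast hm)).ne'
  simp only [Function.comp_apply, closeness]
  push_cast
  rw [Real.sqrt_mul (by norm_num)]
  field_simp

/-- The conditional characteristic functions of the products of the votes. -/
lemma tendsto_prodPhase_cexp (θ : Fin 3 → ℝ) :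
    Tendsto (fun m : ℕ => (∑ ω ∈ closeProfiles m (closeness (3 * m)),
        Complex.exp (Complex.I * (∑ j, (√(m : ℝ))⁻¹ * prodPhase θ (ω j) : ℝ))) /
        (closeProfiles m (closeness (3 * m))).card) (atTop ⊓ 𝓟 {m | Odd m})
      (𝓝 (Real.exp (-(28 / 27 * ∑ k, θ k ^ 2 - 1 / 27 * (∑ k, θ k) ^ 2) / 2) : ℝ)) := by
  have h := tendsto_conditional_cexp odd_tripletSum sum_tripletSum (sum_prodPhase θ)
    (sum_tripletSum_mul_prodPhase θ) (phaseDecay_triplet θ) oddWindow_closeness_nonempty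
    tendsto_inv_sqrt_mul_closeness
  rw [average_prodPhase_sq] at h
  refine h.congr fun m => ?_
  rw [closeProfiles, Finset.sum_filter, Finset.natCast_card_filter]
  congr 1 <;> exact Finset.sum_congr rfl fun ω _ => by congr

lemma tendsto_two_mul_add_one_odd :
    Tendsto (fun n : ℕ => 2 * n + 1) atTop (atTop ⊓ 𝓟 {m | Odd m}) := by
  refine tendsto_inf.2 ⟨?_, tendsto_principal.2 (Eventually.of_forall fun n => ⟨n, rfl⟩)⟩
  exact tendsto_atTop_mono (fun n => (by omega : n ≤ 2 * n + 1)) tendsto_id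

lemma closeProfiles_nonempty :
    ∀ᶠ m in atTop ⊓ 𝓟 {m | Odd m}, (closeProfiles m (closeness (3 * m))).Nonempty := by
  have h := tendsto_prodPhase_cexp 0
  have hne := h.eventually_mem (isOpen_ne.mem_nhds
    (Complex.ofReal_ne_zero.2 (Real.exp_pos _).ne'))
  filter_upwards [hne] with m hm
  rw [Finset.nonempty_iff_ne_empty]
  intro h0
  simp [h0] at hm

/-- The conditional characteristic functions of the decisions of the triplets. -/
lemma tendsto_levelSum_cexp (θ : Fin 3 → ℝ) :
    Tendsto (fun m : ℕ => (∑ ω ∈ closeProfiles m (closeness (3 * m)),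
        Complex.exp (Complex.I * (∑ k, θ k * ((√(m : ℝ))⁻¹ * levelSum ω k) : ℝ))) /
        (closeProfiles m (closeness (3 * m))).card) (atTop ⊓ 𝓟 {m | Odd m})
      (𝓝 (Real.exp (-(28 / 27 * ∑ k, θ k ^ 2 - 1 / 27 * (∑ k, θ k) ^ 2) / 2) : ℝ)) := by
  have h := tendsto_prodPhase_cexp (-θ)
  simp only [Pi.neg_apply, neg_sq, Finset.sum_neg_distrib] at h
  rw [← add_zero (Complex.ofReal _)]
  have hsmall : Tendsto (fun m : ℕ => (∑ k, |θ k|) * ((√(m : ℝ))⁻¹ * closeness (3 * m)))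
      (atTop ⊓ 𝓟 {m | Odd m}) (𝓝 0) := by
    simpa using (tendsto_inv_sqrt_mul_closeness.const_mul (∑ k, |θ k|)).mono_left inf_le_left
  have hdiff := squeeze_zero_norm' (f := fun m : ℕ =>
      (∑ ω ∈ closeProfiles m (closeness (3 * m)),
        Complex.exp (Complex.I * (∑ k, θ k * ((√(m : ℝ))⁻¹ * levelSum ω k) : ℝ))) /
        (closeProfiles m (closeness (3 * m))).card -
      (∑ ω ∈ closeProfiles m (closeness (3 * m)),
        Complex.exp (Complex.I * (∑ j, (√(m : ℝ))⁻¹ * prodPhase (-θ) (ω j) : ℝ))) /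
        (closeProfiles m (closeness (3 * m))).card) ?_ hsmall
  · exact (h.add hdiff).congr fun m => by ring
  · filter_upwards [closeProfiles_nonempty] with m hm
    have hN : (0 : ℝ) < (closeProfiles m (closeness (3 * m))).card := by exact_mod_cast hm.card_pos
    rw [← sub_div, norm_div, Complex.norm_natCast, div_le_iff₀ hN, ← Finset.sum_sub_distrib]
    refine (norm_sum_le _ _).trans ((Finset.sum_le_card_nsmul _ _ _ fun ω hω => ?_).trans_eq
      ((nsmul_eq_mul _ _).trans (mul_comm _ _)))
    refine (norm_cexp_I_mul_sub_le _ _).trans ?_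
    have hω' : ∀ k, |((∑ j, tripletSum (ω j) k : ℤ) : ℝ)| ≤ closeness (3 * m) :=
      (Finset.mem_filter.1 hω).2
    have e : ∑ k, θ k * ((√(m : ℝ))⁻¹ * levelSum ω k) - ∑ j, (√(m : ℝ))⁻¹ * prodPhase (-θ) (ω j)
        = ∑ k, θ k * ((√(m : ℝ))⁻¹ * ((∑ j, tripletSum (ω j) k : ℤ) : ℝ)) := by
      have e1 : ∑ j, (√(m : ℝ))⁻¹ * prodPhase (-θ) (ω j)
          = ∑ k, θ k * ((√(m : ℝ))⁻¹ * -((∑ j, tripletProd (ω j) k : ℤ) : ℝ)) := by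
        simp_rw [prodPhase, Finset.mul_sum]
        rw [Finset.sum_comm]
        refine Finset.sum_congr rfl fun k _ => ?_
        push_cast
        rw [← Finset.sum_neg_distrib, Finset.mul_sum, Finset.mul_sum]
        exact Finset.sum_congr rfl fun j _ => by simp; ring
      rw [e1, ← Finset.sum_sub_distrib]
      refine Finset.sum_congr rfl fun k _ => ?_
      rw [levelSum_eq_sub]
      push_cast
      ring
    rw [e, Finset.sum_mul]
    refine (Finset.abs_sum_le_sum_abs _ _).trans (Finset.sum_le_sum fun k _ => ?_)
    rw [abs_mul, abs_mul, abs_of_nonneg (by positivity : 0 ≤ (√(m : ℝ))⁻¹)]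
    gcongr
    exact hω' k

/-- The normalized sum and difference of two of the level sums. -/
def planarStatistic {m : ℕ} (k l : Fin 3) (ω : Fin m → Fin 3 → Ranking) :
    EuclideanSpace ℝ (Fin 2) :=
  !₂[(2 * √(13 / 27))⁻¹ * ((√(m : ℝ))⁻¹ * (levelSum ω k + levelSum ω l)),
    (2 * √(14 / 27))⁻¹ * ((√(m : ℝ))⁻¹ * (levelSum ω k - levelSum ω l))]

lemma planarStatistic_mem_sector {m : ℕ} (hm : 0 < m) (k l : Fin 3)
    (ω : Fin m → Fin 3 → Ranking) :
    (planarStatistic k l ω 0, planarStatistic k l ω 1) ∈ sector (1 / 27)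
      ↔ 0 < levelSum ω k * levelSum ω l := by
  have hm' : (0 : ℝ) < m := by exact_mod_cast hm
  have e : ∀ x y : ℝ, (1 / 27 * (x ^ 2 + y ^ 2) < x ^ 2 - y ^ 2 ↔ 14 * y ^ 2 < 13 * x ^ 2) := by
    intro x y
    constructor <;> intro h <;> linarith
  simp only [sector, planarStatistic, Set.mem_ofPred_eq, e]
  simp only [Matrix.cons_val_zero, Matrix.cons_val_one, mul_pow, inv_pow,
    Real.sq_sqrt hm'.le, Real.sq_sqrt (show (0 : ℝ) ≤ 13 / 27 by norm_num),
    Real.sq_sqrt (show (0 : ℝ) ≤ 14 / 27 by norm_num)]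
  rw [← Int.cast_pos (R := ℝ), Int.cast_mul, ← sub_pos]
  have e2 : ∀ a b : ℝ, 13 * ((2 ^ 2 * (13 / 27) : ℝ)⁻¹ * ((m : ℝ)⁻¹ * (a + b) ^ 2))
      - 14 * ((2 ^ 2 * (14 / 27) : ℝ)⁻¹ * ((m : ℝ)⁻¹ * (a - b) ^ 2)) = 27 / m * (a * b) := by
    intro a b; field_simp; ring
  rw [e2]
  exact mul_pos_iff_of_pos_left (by positivity)

lemma tendsto_planarStatistic_cexp {k l : Fin 3} (hkl : k ≠ l) (t : EuclideanSpace ℝ (Fin 2)) :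
    Tendsto (fun m : ℕ => (∑ ω ∈ closeProfiles m (closeness (3 * m)),
        Complex.exp (Complex.I * (inner ℝ (planarStatistic k l ω) t : ℝ))) /
        (closeProfiles m (closeness (3 * m))).card) (atTop ⊓ 𝓟 {m | Odd m})
      (𝓝 (charFun (stdGaussian (EuclideanSpace ℝ (Fin 2))) t)) := by
  set α := (2 * √(13 / 27))⁻¹ * t 0 with hα
  set β := (2 * √(14 / 27))⁻¹ * t 1 with hβ
  have hα2 : α ^ 2 = 27 / 52 * t 0 ^ 2 := by
    rw [hα, mul_pow, inv_pow, mul_pow, Real.sq_sqrt (by norm_num)]; norm_num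
  have hβ2 : β ^ 2 = 27 / 56 * t 1 ^ 2 := by
    rw [hβ, mul_pow, inv_pow, mul_pow, Real.sq_sqrt (by norm_num)]; norm_num
  set θ : Fin 3 → ℝ := Pi.single k (α + β) + Pi.single l (α - β) with hθ
  have hθf : ∀ f : Fin 3 → ℝ, ∑ i, θ i * f i = (α + β) * f k + (α - β) * f l := by
    intro f
    simp only [hθ, Pi.add_apply, add_mul, Finset.sum_add_distrib, Pi.single_apply, ite_mul,
      zero_mul, Finset.sum_ite_eq', Finset.mem_univ, if_true]
  have hθ1 : ∑ i, θ i = 2 * α := by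
    have := hθf 1
    simp only [Pi.one_apply, mul_one] at this
    rw [this]; ring
  have hθ2 : ∑ i, θ i ^ 2 = 2 * (α ^ 2 + β ^ 2) := by
    simp_rw [sq]
    rw [hθf θ]
    simp [hθ, hkl, hkl.symm]
    ring
  have h := tendsto_levelSum_cexp θ
  simp_rw [hθf] at h
  rw [hθ1, hθ2] at h
  refine (h.congr fun m => ?_).trans_eq ?_
  · congr 1
    refine Finset.sum_congr rfl fun ω _ => ?_
    congr 3
    simp only [planarStatistic, PiLp.inner_apply, Fin.sum_univ_two, hα, hβ]
    simp
    ring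
  · have hnorm : ‖t‖ ^ 2 = 28 / 27 * (2 * (α ^ 2 + β ^ 2)) - 1 / 27 * (2 * α) ^ 2 := by
      rw [EuclideanSpace.real_norm_sq_eq, Fin.sum_univ_two]
      linear_combination -(52 / 27) * hα2 - 56 / 27 * hβ2
    rw [charFun_stdGaussian, ← hnorm]
    push_cast
    rfl

/-- Given that the elections are close, two of the decisions agree with probability tending to
`arccos (1 / 27) / π`. -/
theorem tendsto_agreement {k l : Fin 3} (hkl : k ≠ l) :
    Tendsto (fun m : ℕ => agreement m (closeness (3 * m)) k l) (atTop ⊓ 𝓟 {m | Odd m})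
      (𝓝 (Real.arccos (1 / 27) / Real.pi)) := by
  classical
  set S : Set (EuclideanSpace ℝ (Fin 2)) := {x | (x 0, x 1) ∈ sector (1 / 27)} with hS
  have hcont : Continuous fun x : EuclideanSpace ℝ (Fin 2) => (x 0, x 1) := by fun_prop
  have hSm : MeasurableSet S := hcont.measurable (measurableSet_sector _)
  have hfr : stdGaussian (EuclideanSpace ℝ (Fin 2)) (frontier S) = 0 := by
    refine measure_mono_null (t := {x | (x 0, x 1) ∈
      {p : ℝ × ℝ | 1 / 27 * (p.1 ^ 2 + p.2 ^ 2) = p.1 ^ 2 - p.2 ^ 2}}) ?_ ?_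
    · exact frontier_lt_subset_eq
        (f := fun x : EuclideanSpace ℝ (Fin 2) => 1 / 27 * (x 0 ^ 2 + x 1 ^ 2))
        (g := fun x => x 0 ^ 2 - x 1 ^ 2) (by fun_prop) (by fun_prop)
    · rw [stdGaussian_apply (measurableSet_eq_fun (by fun_prop) (by fun_prop))]
      exact gaussianReal_prod_sector_boundary (by norm_num)
  have h := tendsto_card_filter_div_card
    (fun n => closeProfiles (2 * n + 1) (closeness (3 * (2 * n + 1))))
    (fun n => planarStatistic k l)
    ⟨stdGaussian (EuclideanSpace ℝ (Fin 2)), inferInstance⟩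
    (tendsto_two_mul_add_one_odd.eventually closeProfiles_nonempty)
    (fun t => (tendsto_planarStatistic_cexp hkl t).comp tendsto_two_mul_add_one_odd) hSm hfr
  have hval : (stdGaussian (EuclideanSpace ℝ (Fin 2))).real S = Real.arccos (1 / 27) / Real.pi := by
    rw [← gaussianReal_prod_sector (by norm_num) (by norm_num), measureReal_def, measureReal_def,
      hS, stdGaussian_apply (measurableSet_sector _)]
  have hagree : ∀ n : ℕ, (((closeProfiles (2 * n + 1) (closeness (3 * (2 * n + 1)))).filter
      fun ω => planarStatistic k l ω ∈ S).card : ℝ) /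
      (closeProfiles (2 * n + 1) (closeness (3 * (2 * n + 1)))).card
      = agreement (2 * n + 1) (closeness (3 * (2 * n + 1))) k l := by
    intro n
    rw [agreement]
    congr 3
    exact Finset.filter_congr fun ω _ => planarStatistic_mem_sector (by omega) k l ω
  have h' : Tendsto (fun n : ℕ => agreement (2 * n + 1) (closeness (3 * (2 * n + 1))) k l) atTop
      (𝓝 (Real.arccos (1 / 27) / Real.pi)) := by
    rw [← hval]
    exact h.congr hagree
  have hhalf : Tendsto (fun m : ℕ => m / 2) (atTop ⊓ 𝓟 {m | Odd m}) atTop :=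
    (Nat.tendsto_div_const_atTop two_ne_zero).mono_left inf_le_left
  refine (h'.comp hhalf).congr' ?_
  have hodd : ∀ᶠ m in atTop ⊓ 𝓟 {m : ℕ | Odd m}, Odd m :=
    eventually_inf_principal.2 (Eventually.of_forall fun m hm => hm)
  filter_upwards [hodd] with m hm
  simp only [Function.comp_apply, Nat.two_mul_div_two_add_one_of_odd hm]

theorem tendsto_cond_condorcetParadox :
    Tendsto (fun m : ℕ => (cond (impartialCulture (3 * m))
      (closeElections (3 * m) (closeness (3 * m)))).real (condorcetParadox m))
      (atTop ⊓ 𝓟 {m | Odd m})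
      (𝓝 (1 / 4 - 3 / (2 * Real.pi) * Real.arcsin (1 / 27))) := by
  have h := ((((tendsto_agreement (k := 0) (l := 1) (by decide)).add
    (tendsto_agreement (k := 1) (l := 2) (by decide))).add
    (tendsto_agreement (k := 2) (l := 0) (by decide))).sub_const 1).div_const 2
  have hval : (Real.arccos (1 / 27) / Real.pi + Real.arccos (1 / 27) / Real.pi
      + Real.arccos (1 / 27) / Real.pi - 1) / 2
      = 1 / 4 - 3 / (2 * Real.pi) * Real.arcsin (1 / 27) := by
    rw [Real.arccos]
    field_simp
    ring
  rw [hval] at h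
  refine h.congr' ?_
  have hodd : ∀ᶠ m in atTop ⊓ 𝓟 {m : ℕ | Odd m}, Odd m :=
    eventually_inf_principal.2 (Eventually.of_forall fun m hm => hm)
  filter_upwards [hodd, closeProfiles_nonempty] with m hm hne
  exact (cond_condorcetParadox_eq hm hne).symm

lemma arcsin_one_div_bounds :
    1 / 27 ≤ Real.arcsin (1 / 27) ∧ Real.arcsin (1 / 27) ≤ 38 / 1000 := by
  have hpi := Real.pi_gt_three
  constructor
  · rw [Real.le_arcsin_iff_sin_le' ⟨by linarith, by linarith⟩]
    exact Real.sin_le (by norm_num)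
  · rw [Real.arcsin_le_iff_le_sin' ⟨by linarith, by linarith⟩]
    have := Real.sin_gt_sub_cube (x := 38 / 1000) (by norm_num)
    norm_num at this ⊢
    linarith

end Limit

end MajorityOfTriplets

end

/-- The limit is along the odd numbers `m`, that is, along the odd numbers `n = 3 * m` of voters. -/
theorem mainTheorem4 :
    ∃ α : ℝ,
      Tendsto
        (fun m : ℕ =>
          (cond (MajorityOfTriplets.impartialCulture (3 * m))
            (MajorityOfTriplets.closeElections (3 * m)
              (MajorityOfTriplets.closeness (3 * m)))).real
            (MajorityOfTriplets.condorcetParadox m))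
        (atTop ⊓ 𝓟 {m : ℕ | Odd m}) (𝓝 α) ∧
      |α - 0.232| < 0.0005 ∧ α ≠ 1 / 4 := by
  refine ⟨_, MajorityOfTriplets.tendsto_cond_condorcetParadox, ?_⟩
  obtain ⟨h1, h2⟩ := MajorityOfTriplets.arcsin_one_div_bounds
  have hlo : 0.0175 < 3 / (2 * Real.pi) * Real.arcsin (1 / 27) := by
    rw [div_mul_eq_mul_div, lt_div_iff₀ (by positivity)]
    linarith [Real.pi_lt_d2]
  have hhi : 3 / (2 * Real.pi) * Real.arcsin (1 / 27) < 0.0185 := by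
    rw [div_mul_eq_mul_div, div_lt_iff₀ (by positivity)]
    linarith [Real.pi_gt_d2]
  refine ⟨abs_lt.2 ⟨by linarith, by linarith⟩, fun h => by linarith⟩
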